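/- **Trees.** A labeled tree $\theta=(\tau,\ell)$ is a locally finite rooted plane tree $\tau$ with labels $\ell:\tau\to\mathbb Z$ that differ by at most $1$ along each edge. Labeled trees carry the local distance $d_{\mathbf T}(\theta,\theta')=(1+\sup\{h\ge 0: B_{\mathbf T,h}(\theta)=B_{\mathbf T,h}(\theta')\})^{-1}$, where $B_{\mathbf T,h}(\theta)$ is the labeled subtree of the vertices up to height $h$. Let $\mathbf T_f^{(0)}$ be the set of finite labeled trees with root label $0$ and at least one edge. Let $\mathscr S$ be the set of infinite labeled trees with root label $0$ that have exactly one spine (infinite path $\mathrm S(0),\mathrm S(1),\dots$ starting at the root, each $\mathrm S(i)$ being the parent of $\mathrm S(i+1)$) and satisfy $\inf_i\ell(\mathrm S(i))=-\infty$. **Quadrangulations.** Let $\mathbf Q_f$ be the set of finite rooted planar maps (up to orientation-preserving homeomorphism) with at least one face, all of whose faces have degree $4$. For $r\ge 1$ let $B_{\mathbf Q,r}(q)$ be the rooted map formed by the edges and vertices incident to a face of $q$ that has a vertex at graph distance $<r$ from the origin of the root edge (and let $B_{\mathbf Q,0}(q)$ be empty). Let $(\mathbf Q,d_{\mathbf Q})$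 be the completion of $\mathbf Q_f$ for $d_{\mathbf Q}(q,q')=(1+\sup\{r\ge 1: B_{\mathbf Q,r}(q)=B_{\mathbf Q,r}(q')\})^{-1}$ ($\sup\varnothing=0$). The elements of $\mathbf Q$ are rooted locally finite maps, with the same definition of balls; those of $\mathbf Q\setminus\mathbf Q_f$ are the infinite quadrangulations. An infinite quadrangulation $q$ is a *quadrangulation of the plane* if it is one-ended: for every $r\ge 0$ the graph $q\setminus B_{\mathbf Q,r}(q)$, obtained by deleting the vertices of the ball with their edges, has exactly one infinite connected component. **The map $\Phi$.** Let $\theta\in\mathscr S\cup\mathbf T_f^{(0)}$ and $\eta\in\{0,1\}$. A vertex of $\tau$ of degree $k$ has $k$ corners. The corners are ordered by the clockwise contour of $\tau$ (cyclically if $\tau$ is finite, as $\mathbb Z$ if $\theta\in\mathscr S$), the root corner $c_0$ being the corner of the root to the left of the edge to its first child. The successor of a corner $c$ is the first corner strictly after $c$ in this order with label $\ell(c)-1$; if there is none (which occurs only if $\tau$ is finite) it is an extra vertex $\rho$. Draw, without crossings, an arc from every corner to its successor and delete the edges of $\tau$. The resulting map, whose vertex set is $\tau$ if $\theta\in\mathscr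 S$ and $\tau\cup\{\rho\}$ if $\tau$ is finite, is rooted at the arc of $c_0$, oriented from $c_0$ to its successor if $\eta=0$ and in the opposite direction if $\eta=1$. It is denoted by $\Phi(\theta,\eta)$. **Proposition.** For all $\theta\in\mathscr S\cup\mathbf T_f^{(0)}$ and $\eta\in\{0,1\}$ one has $\Phi(\theta,\eta)\in\mathbf Q$. If $\theta\in\mathscr S$, then $\Phi(\theta,\eta)$ is an infinite quadrangulation of the plane. For each $\eta$, the mapping $\Phi(\cdot,\eta):\mathscr S\cup\mathbf T_f^{(0)}\to\mathbf Q$ is continuous for the distances $d_{\mathbf T}$ and $d_{\mathbf Q}$. -/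

import Mathlib

open scoped ENNReal

noncomputable section

/-! ### Local distances -/

/-- The number `(1 + sup {r : P r})⁻¹`, with `sup ∅ = 0` and `∞⁻¹ = 0`. -/
def localDist (P : ℕ → Prop) : ℝ≥0∞ := (1 + ⨆ (r : ℕ) (_ : P r), (r : ℝ≥0∞))⁻¹

/-- The topology of a distance `d`: a set is open if it contains, with each of its points `x`,
all points `y` with `d x y < ε`, for some `ε > 0`. -/
abbrev topologyOfDist {X : Type*} (d : X → X → ℝ≥0∞) : TopologicalSpace X where
  IsOpen U := ∀ x ∈ U, ∃ ε > 0, ∀ y, d x y < ε → y ∈ U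
  isOpen_univ := fun _ _ => ⟨1, one_pos, fun _ _ => trivial⟩
  isOpen_inter := by
    rintro U V hU hV x ⟨hxU, hxV⟩
    obtain ⟨ε, hε, h⟩ := hU x hxU
    obtain ⟨δ, hδ, h'⟩ := hV x hxV
    exact ⟨min ε δ, lt_min hε hδ, fun y hy =>
      ⟨h y (hy.trans_le (min_le_left _ _)), h' y (hy.trans_le (min_le_right _ _))⟩⟩
  isOpen_sUnion := by
    rintro S hS x ⟨U, hU, hx⟩
    obtain ⟨ε, hε, h⟩ := hS U hU x hx
    exact ⟨ε, hε, fun y hy => ⟨U, hU, h y hy⟩⟩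

/-! ### Rooted maps as rotation systems -/

/-- A rooted rotation system. A dart is an oriented edge `d`, with reversal `rev d`;
`rot d` is the dart that follows `d` in clockwise order among the darts with the same origin,
and `root` is the root edge. (That `rot` is a permutation with finite cycles is required
below, in `RootedMap.IsQuadrangulation`.) -/
structure RootedMap where
  Dart : Type
  rot : Dart → Dart
  rev : Dart → Dart
  rev_rev : ∀ d, rev (rev d) = d
  rev_ne : ∀ d, rev d ≠ d
  root : Dart

namespace RootedMap

/-- The vertices are the cycles of `rot`. -/
def Vertex (m : RootedMap) : Type := Quot fun d d' : m.Dart => m.rot d = d'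

/-- The (unoriented) edges are the pairs `{d, rev d}`. -/
def Edge (m : RootedMap) : Type := Quot fun d d' : m.Dart => m.rev d = d'

/-- The next dart along the boundary of the face that lies to the left of `d`. -/
def faceNext (m : RootedMap) (d : m.Dart) : m.Dart := m.rot (m.rev d)

/-- The faces are the cycles of `faceNext`. -/
def Face (m : RootedMap) : Type := Quot fun d d' : m.Dart => m.faceNext d = d'

/-- The origin of a dart. -/
def origin (m : RootedMap) (d : m.Dart) : m.Vertex := Quot.mk _ d

/-- The graph of a map (without its loops and its edge multiplicities, which are irrelevant for
distances and for connectedness). -/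
def graph (m : RootedMap) : SimpleGraph m.Vertex :=
  SimpleGraph.fromRel fun v w => ∃ d, m.origin d = v ∧ m.origin (m.rev d) = w

/-- The graph distance from the root vertex (the origin of the root edge) to the origin of `d`. -/
def rootDist (m : RootedMap) (d : m.Dart) : ℕ∞ := m.graph.edist (m.origin m.root) (m.origin d)

/-- A connected, locally finite map all of whose faces have degree 4. Without planarity: such a
map is a quadrangulation of a connected oriented surface without boundary. -/
structure IsQuadrangulation (m : RootedMap) : Prop where
  connected : m.graph.Connected
  locallyFinite : ∀ d, d ∈ Function.periodicPts m.rot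
  face_degree : ∀ d, Function.minimalPeriod m.faceNext d = 4

/-- A finite planar quadrangulation: planarity is Euler's formula `V - E + F = 2`. -/
structure IsFinitePlanarQuadrangulation (m : RootedMap) : Prop extends m.IsQuadrangulation where
  finite : Finite m.Dart
  euler : Nat.card m.Vertex + Nat.card m.Face = Nat.card m.Edge + 2

/-- The face to the left of `d` has a vertex at distance `< r` from the root vertex. -/
def NearFace (m : RootedMap) (r : ℕ) (d : m.Dart) : Prop :=
  ∃ k : ℕ, m.rootDist (m.faceNext^[k] d) < r

/-- The edge of `d` is incident to a face that has a vertex at distance `< r` from the root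
vertex. -/
def InBall (m : RootedMap) (r : ℕ) (d : m.Dart) : Prop := m.NearFace r d ∨ m.NearFace r (m.rev d)

theorem InBall.rev {m : RootedMap} {r : ℕ} {d : m.Dart} (h : m.InBall r d) :
    m.InBall r (m.rev d) := by
  unfold InBall at *
  rw [m.rev_rev]
  exact h.symm

theorem inBall_root (m : RootedMap) {r : ℕ} (hr : 0 < r) : m.InBall r m.root := by
  refine Or.inl ⟨0, ?_⟩
  simp only [Function.iterate_zero, id_eq, rootDist, SimpleGraph.edist_self]
  exact_mod_cast hr

open Classical in
/-- The map that consists of the edges (and their end points) incident to a face having a vertex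
at distance `< r` from the root vertex. The dart that follows `d` clockwise in this map is the
first of `rot d`, `rot (rot d)`, … that is kept. -/
def ball (r : ℕ) (hr : 0 < r) (m : RootedMap) : RootedMap where
  Dart := {d : m.Dart // m.InBall r d}
  rot d := if h : ∃ n, 0 < n ∧ m.InBall r (m.rot^[n] d.1) then
      ⟨m.rot^[Nat.find h] d.1, (Nat.find_spec h).2⟩ else d
  rev d := ⟨m.rev d.1, d.2.rev⟩
  rev_rev d := Subtype.ext (m.rev_rev d.1)
  rev_ne d h := m.rev_ne d.1 (congrArg Subtype.val h)
  root := ⟨m.root, m.inBall_root hr⟩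

/-- The vertices that belong to the ball of radius `r`. -/
def ballVertices (m : RootedMap) (r : ℕ) : Set m.Vertex := {v | ∃ d, m.InBall r d ∧ m.origin d = v}

/-- For every `r ≥ 0`, the graph without the vertices of its ball of radius `r` (and the edges
incident to them) has exactly one infinite connected component. -/
def OneEnded (m : RootedMap) : Prop :=
  ∀ r : ℕ, ∃! C : (m.graph.induce (m.ballVertices r)ᶜ).ConnectedComponent, C.supp.Infinite

/-- Two rooted maps are the same if there is a bijection of their darts that respects the
rotation, the reversal and the root (that is, an orientation-preserving isomorphism of rooted
maps). -/
structure Iso (m m' : RootedMap) where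
  toEquiv : m.Dart ≃ m'.Dart
  rot : ∀ d, toEquiv (m.rot d) = m'.rot (toEquiv d)
  rev : ∀ d, toEquiv (m.rev d) = m'.rev (toEquiv d)
  root : toEquiv m.root = m'.root

namespace Iso

variable {m m' m'' : RootedMap}

def refl (m : RootedMap) : Iso m m := ⟨Equiv.refl _, fun _ => rfl, fun _ => rfl, rfl⟩

def symm (e : Iso m m') : Iso m' m where
  toEquiv := e.toEquiv.symm
  rot d := by rw [Equiv.symm_apply_eq, e.rot, Equiv.apply_symm_apply]
  rev d := by rw [Equiv.symm_apply_eq, e.rev, Equiv.apply_symm_apply]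
  root := by rw [Equiv.symm_apply_eq, e.root]

def trans (e : Iso m m') (f : Iso m' m'') : Iso m m'' where
  toEquiv := e.toEquiv.trans f.toEquiv
  rot d := by simp [e.rot, f.rot]
  rev d := by simp [e.rev, f.rev]
  root := by simp [e.root, f.root]

theorem rot_iterate (e : Iso m m') (n : ℕ) (d : m.Dart) :
    e.toEquiv (m.rot^[n] d) = m'.rot^[n] (e.toEquiv d) := by
  induction n with
  | zero => rfl
  | succ n ih => rw [Function.iterate_succ_apply', Function.iterate_succ_apply', e.rot, ih]

theorem faceNext_iterate (e : Iso m m') (n : ℕ) (d : m.Dart) :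
    e.toEquiv (m.faceNext^[n] d) = m'.faceNext^[n] (e.toEquiv d) := by
  induction n with
  | zero => rfl
  | succ n ih =>
    rw [Function.iterate_succ_apply', Function.iterate_succ_apply', faceNext, faceNext, e.rot,
      e.rev, ih]

/-- The map between the vertices that is induced by an isomorphism. -/
def vertexMap (e : Iso m m') : m.Vertex → m'.Vertex :=
  Quot.map e.toEquiv fun d d' h => by rw [← h, e.rot]

theorem vertexMap_origin (e : Iso m m') (d : m.Dart) :
    e.vertexMap (m.origin d) = m'.origin (e.toEquiv d) := rfl

theorem vertexMap_injective (e : Iso m m') : Function.Injective e.vertexMap := by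
  have h : Function.LeftInverse e.symm.vertexMap e.vertexMap := by
    rintro ⟨d⟩
    exact congrArg m.origin (e.toEquiv.symm_apply_apply d)
  exact h.injective

/-- The graph homomorphism that is induced by an isomorphism. -/
def graphHom (e : Iso m m') : m.graph →g m'.graph where
  toFun := e.vertexMap
  map_rel' := by
    have key : ∀ v w, (∃ d, m.origin d = v ∧ m.origin (m.rev d) = w) →
        ∃ d, m'.origin d = e.vertexMap v ∧ m'.origin (m'.rev d) = e.vertexMap w := by
      rintro _ _ ⟨d, rfl, rfl⟩
      exact ⟨e.toEquiv d, rfl, by rw [vertexMap_origin, e.rev]⟩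
    intro v w h
    rw [graph, SimpleGraph.fromRel_adj] at h ⊢
    exact ⟨e.vertexMap_injective.ne h.1, h.2.imp (key _ _) (key _ _)⟩

theorem rootDist_le (e : Iso m m') (d : m.Dart) : m'.rootDist (e.toEquiv d) ≤ m.rootDist d := by
  have h : m'.rootDist (e.toEquiv d) =
      m'.graph.edist (e.graphHom (m.origin m.root)) (e.graphHom (m.origin d)) := by
    change _ = m'.graph.edist (m'.origin (e.toEquiv m.root)) (m'.origin (e.toEquiv d))
    rw [e.root, rootDist]
  rw [h]
  refine le_iInf fun w => ?_
  have := SimpleGraph.edist_le (w.map e.graphHom)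
  rwa [SimpleGraph.Walk.length_map] at this

theorem inBall (e : Iso m m') {r : ℕ} {d : m.Dart} (h : m.InBall r d) :
    m'.InBall r (e.toEquiv d) := by
  have key : ∀ d, m.NearFace r d → m'.NearFace r (e.toEquiv d) := by
    rintro d ⟨k, hk⟩
    exact ⟨k, by rw [← e.faceNext_iterate]; exact (e.rootDist_le _).trans_lt hk⟩
  refine h.imp (key d) fun h => ?_
  rw [← e.rev]
  exact key _ h

theorem inBall_iff (e : Iso m m') {r : ℕ} {d : m.Dart} :
    m'.InBall r (e.toEquiv d) ↔ m.InBall r d :=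
  ⟨fun h => by simpa [symm] using e.symm.inBall h, e.inBall⟩

/-- Isomorphic maps have isomorphic balls. -/
def ball (e : Iso m m') (r : ℕ) (hr : 0 < r) : Iso (m.ball r hr) (m'.ball r hr) where
  toEquiv := e.toEquiv.subtypeEquiv fun _ => e.inBall_iff.symm
  rot := by
    classical
    rintro ⟨d, hd⟩
    apply Subtype.ext
    have hiff : ∀ n, (0 < n ∧ m'.InBall r (m'.rot^[n] (e.toEquiv d))) ↔
        (0 < n ∧ m.InBall r (m.rot^[n] d)) := fun n => by
      rw [← e.rot_iterate, e.inBall_iff]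
    change e.toEquiv ((m.ball r hr).rot ⟨d, hd⟩).1 =
      ((m'.ball r hr).rot ⟨e.toEquiv d, e.inBall hd⟩).1
    simp only [RootedMap.ball]
    by_cases h : ∃ n, 0 < n ∧ m.InBall r (m.rot^[n] d)
    · have h' : ∃ n, 0 < n ∧ m'.InBall r (m'.rot^[n] (e.toEquiv d)) := by
        simpa only [hiff] using h
      rw [dif_pos h, dif_pos h']
      have hn : Nat.find h' = Nat.find h := Nat.find_congr' fun {n} => hiff n
      change e.toEquiv (m.rot^[Nat.find h] d) = m'.rot^[Nat.find h'] (e.toEquiv d)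
      rw [hn, e.rot_iterate]
    · have h' : ¬ ∃ n, 0 < n ∧ m'.InBall r (m'.rot^[n] (e.toEquiv d)) := by
        simpa only [hiff] using h
      rw [dif_neg h, dif_neg h']
  rev := by
    rintro ⟨d, hd⟩
    exact Subtype.ext (e.rev d)
  root := Subtype.ext e.root

end Iso

instance setoid : Setoid RootedMap where
  r m m' := Nonempty (Iso m m')
  iseqv := ⟨fun m => ⟨Iso.refl m⟩, fun ⟨e⟩ => ⟨e.symm⟩, fun ⟨e⟩ ⟨f⟩ => ⟨e.trans f⟩⟩

end RootedMap

/-- Rooted maps up to isomorphism. -/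
def MapClass : Type 1 := Quotient RootedMap.setoid

/-- The class of a rooted map. -/
def RootedMap.toClass (m : RootedMap) : MapClass := Quotient.mk RootedMap.setoid m

/-- The ball of radius `r ≥ 1` of (the class of) a rooted map. -/
def MapClass.ball (r : ℕ) (hr : 0 < r) : MapClass → MapClass :=
  Quotient.map (RootedMap.ball r hr) fun _ _ ⟨e⟩ => ⟨e.ball r hr⟩

/-! ### The space of quadrangulations -/

/-- Rooted quadrangulations, finite or infinite, of connected oriented surfaces. -/
def QuadSpace : Type 1 := {x : MapClass // ∃ m : RootedMap, m.toClass = x ∧ m.IsQuadrangulation}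

/-- The local distance `(1 + sup {r ≥ 1 : B_r(x) = B_r(y)})⁻¹`. -/
def QuadSpace.dist (x y : QuadSpace) : ℝ≥0∞ :=
  localDist fun r => ∃ hr : 0 < r, x.1.ball r hr = y.1.ball r hr

instance : TopologicalSpace QuadSpace := topologyOfDist QuadSpace.dist

/-- The set of finite rooted planar quadrangulations. -/
def finiteQuad : Set QuadSpace :=
  {x | ∃ m : RootedMap, m.toClass = x.1 ∧ m.IsFinitePlanarQuadrangulation}

/-- The space of finite and infinite rooted planar quadrangulations: the completion of the set of
finite ones for the local distance. `QuadSpace` is complete for this distance (a sequence of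
compatible balls determines a map), so that the completion is a closure. -/
def Quad : Set QuadSpace := closure finiteQuad

/-- Infinite quadrangulations: the elements of `Quad` that are not finite quadrangulations. -/
def infiniteQuad : Set QuadSpace := Quad \ finiteQuad

/-- Infinite quadrangulations of the plane: the one-ended infinite quadrangulations. -/
def planeQuad : Set QuadSpace :=
  {x | x ∈ infiniteQuad ∧ ∃ m : RootedMap, m.toClass = x.1 ∧ m.OneEnded}

/-! ### Labeled trees -/

/-- A rooted plane tree, as a set of words. The letters are `0, 1, 2, …`, and a word is written
from its last letter to its first one: `j :: u` is the child number `j + 1` of `u`, and the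
children of `u` are `0 :: u, …, (k - 1) :: u` from left to right, with `k = numChildren u`
(which is `0` if `u` is not in the tree). -/
structure PlaneTree where
  verts : Set (List ℕ)
  root_mem : [] ∈ verts
  parent_mem : ∀ u j, j :: u ∈ verts → u ∈ verts
  numChildren : List ℕ → ℕ
  child_mem_iff : ∀ u j, j :: u ∈ verts ↔ j < numChildren u

/-- A plane tree with integer labels that vary by at most 1 along the edges. -/
structure LabeledTree extends PlaneTree where
  label : verts → ℤ
  abs_label_sub_le : ∀ u j (h : j :: u ∈ verts),
    |label ⟨j :: u, h⟩ - label ⟨u, parent_mem u j h⟩| ≤ 1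

namespace LabeledTree

/-- The two labeled trees have the same vertices up to height `h`, with the same labels. -/
def SameBall (h : ℕ) (θ θ' : LabeledTree) : Prop :=
  ∀ u : List ℕ, u.length ≤ h → (u ∈ θ.verts ↔ u ∈ θ'.verts) ∧
    ∀ (hu : u ∈ θ.verts) (hu' : u ∈ θ'.verts), θ.label ⟨u, hu⟩ = θ'.label ⟨u, hu'⟩

/-- The local distance `(1 + sup {h ≥ 0 : B_h(θ) = B_h(θ')})⁻¹`. -/
def dist (θ θ' : LabeledTree) : ℝ≥0∞ := localDist fun h => SameBall h θ θ'

instance : TopologicalSpace LabeledTree := topologyOfDist dist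

/-- The root of a tree. -/
def rootVert (θ : LabeledTree) : θ.verts := ⟨[], θ.root_mem⟩

/-- A spine: an infinite path from the root, each vertex being the parent of the next one. -/
def IsSpine (θ : LabeledTree) (S : ℕ → θ.verts) : Prop :=
  S 0 = θ.rootVert ∧ ∀ i, ∃ j, (S (i + 1)).1 = j :: (S i).1

/-- The set `𝒮` of the infinite labeled trees with root label `0` that have exactly one spine, and
whose labels along the spine have infimum `-∞`. -/
def oneSpineTrees : Set LabeledTree :=
  {θ | θ.verts.Infinite ∧ θ.label θ.rootVert = 0 ∧
    ∃ S, θ.IsSpine S ∧ (∀ S', θ.IsSpine S' → S' = S) ∧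
      ¬ BddBelow (Set.range fun i => θ.label (S i))}

/-- The finite labeled trees with root label `0` and at least one edge. -/
def finiteTrees : Set LabeledTree :=
  {θ | θ.verts.Finite ∧ θ.label θ.rootVert = 0 ∧ 0 < θ.numChildren []}

theorem numChildren_root_pos {θ : LabeledTree} (h : θ ∈ oneSpineTrees ∪ finiteTrees) :
    0 < θ.numChildren [] := by
  rcases h with ⟨-, -, S, ⟨h0, h1⟩, -⟩ | h
  · obtain ⟨j, hj⟩ := h1 0
    rw [h0] at hj
    exact Nat.zero_lt_of_lt ((θ.child_mem_iff [] j).1 (hj ▸ (S (0 + 1)).2))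
  · exact h.2.2

/-! ### Corners and the contour order -/

/-- `(u, i)` is a corner. For a vertex `u ≠ []` with `k` children, the corners `(u, 0), …, (u, k)`
in clockwise order are separated by the edges to the children: `(u, i)` is followed clockwise by
the edge to `i :: u` if `i < k`, and by the edge to the parent if `i = k`. At the root there is no
edge to a parent and the corners number `0` and `k` are the same, so that only `i < k` is kept:
every vertex has as many corners as its degree. -/
def IsCorner (θ : LabeledTree) (c : List ℕ × ℕ) : Prop :=
  c.1 ∈ θ.verts ∧ c.2 ≤ θ.numChildren c.1 ∧ (c.1 = [] → c.2 < θ.numChildren [])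

/-- The corners of a tree. -/
def Corner (θ : LabeledTree) : Type := {c : List ℕ × ℕ // θ.IsCorner c}

/-- The label of a corner is the label of its vertex. -/
def cornerLabel (θ : LabeledTree) (c : θ.Corner) : ℤ := θ.label ⟨c.1.1, c.2.1⟩

/-- The next corner in the clockwise contour of the tree: from `(u, i)` along the edge to the next
child `i :: u` if there is one, and to the parent otherwise. -/
def nextFun (θ : LabeledTree) : List ℕ × ℕ → List ℕ × ℕ
  | (u, i) =>
    if i < θ.numChildren u then (i :: u, 0)
    else match u with
      | [] => ([], 0)
      | j :: v => if v = [] ∧ j + 1 = θ.numChildren [] then ([], 0) else (v, j + 1)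

/-- The previous corner in the clockwise contour of the tree. -/
def prevFun (θ : LabeledTree) : List ℕ × ℕ → List ℕ × ℕ
  | (u, i + 1) => (i :: u, θ.numChildren (i :: u))
  | (j :: v, 0) => (v, j)
  | ([], 0) => ([θ.numChildren [] - 1], θ.numChildren [θ.numChildren [] - 1])

theorem isCorner_nextFun (θ : LabeledTree) {c : List ℕ × ℕ} (hc : θ.IsCorner c) :
    θ.IsCorner (θ.nextFun c) := by
  obtain ⟨u, i⟩ := c
  obtain ⟨hu, hi, hr⟩ := hc
  dsimp only at hu hi hr
  unfold nextFun
  dsimp only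
  split_ifs with h
  · exact ⟨(θ.child_mem_iff u i).2 h, Nat.zero_le _, fun h' => by simp at h'⟩
  · match u, hu, hi, hr, h with
    | [], _, _, hr, h => exact absurd (hr rfl) h
    | j :: v, hu, _, _, _ =>
      have hj := (θ.child_mem_iff v j).1 hu
      dsimp only
      split_ifs with hv
      · exact ⟨θ.root_mem, Nat.zero_le _, fun _ => by dsimp only; omega⟩
      · refine ⟨θ.parent_mem v j hu, hj, fun h0 => ?_⟩
        dsimp only at h0 ⊢
        subst h0
        have : j + 1 ≠ θ.numChildren [] := fun h1 => hv ⟨rfl, h1⟩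
        omega

theorem isCorner_prevFun (θ : LabeledTree) {c : List ℕ × ℕ} (hc : θ.IsCorner c) :
    θ.IsCorner (θ.prevFun c) := by
  obtain ⟨u, i⟩ := c
  obtain ⟨hu, hi, hr⟩ := hc
  dsimp only at hu hi hr
  match u, i, hu, hi, hr with
  | u, i + 1, _, hi, _ =>
    exact ⟨(θ.child_mem_iff u i).2 hi, le_rfl, fun h' => by simp [prevFun] at h'⟩
  | j :: v, 0, hu, _, _ =>
    have hj := (θ.child_mem_iff v j).1 hu
    refine ⟨θ.parent_mem v j hu, hj.le, fun h' => ?_⟩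
    dsimp only [prevFun] at h' ⊢
    subst h'
    exact hj
  | [], 0, _, _, hr =>
    refine ⟨(θ.child_mem_iff [] _).2 ?_, le_rfl, fun h' => by simp [prevFun] at h'⟩
    have := hr rfl
    omega

theorem prevFun_nextFun (θ : LabeledTree) {c : List ℕ × ℕ} (hc : θ.IsCorner c) :
    θ.prevFun (θ.nextFun c) = c := by
  obtain ⟨u, i⟩ := c
  obtain ⟨hu, hi, hr⟩ := hc
  dsimp only at hu hi hr
  unfold nextFun
  dsimp only
  split_ifs with h
  · rfl
  · have hi' : i = θ.numChildren u := by omega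
    subst hi'
    match u, hu, hr, h with
    | [], _, hr, h => exact absurd (hr rfl) h
    | j :: v, _, _, _ =>
      dsimp only
      split_ifs with hv
      · obtain ⟨rfl, hj⟩ := hv
        have hj' : θ.numChildren [] - 1 = j := by omega
        simp only [prevFun, hj']
      · rfl

theorem nextFun_prevFun (θ : LabeledTree) {c : List ℕ × ℕ} (hc : θ.IsCorner c) :
    θ.nextFun (θ.prevFun c) = c := by
  obtain ⟨u, i⟩ := c
  obtain ⟨hu, hi, hr⟩ := hc
  dsimp only at hu hi hr
  match u, i, hu, hi, hr with
  | u, i + 1, _, _, hr =>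
    have h : ¬ (u = [] ∧ i + 1 = θ.numChildren []) := fun ⟨h1, h2⟩ => (hr h1).ne h2
    simp [prevFun, nextFun, h]
  | j :: v, 0, hu, _, _ =>
    have hj := (θ.child_mem_iff v j).1 hu
    simp [prevFun, nextFun, hj]
  | [], 0, _, _, hr =>
    have h := hr rfl
    have h' : θ.numChildren [] - 1 + 1 = θ.numChildren [] := by omega
    simp [prevFun, nextFun, h']

/-- The clockwise contour of the tree, as a permutation of its corners. It has a single cycle if
the tree is finite. For a tree with exactly one spine, it orders the corners as `ℤ`: if `c₀` is
the root corner, `(contour ^ i) c₀` is the corner number `i` on the left side for `i ≥ 0`, and the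
corner number `-i` on the right side for `i ≤ 0`. -/
def contour (θ : LabeledTree) : Equiv.Perm θ.Corner where
  toFun c := ⟨θ.nextFun c.1, θ.isCorner_nextFun c.2⟩
  invFun c := ⟨θ.prevFun c.1, θ.isCorner_prevFun c.2⟩
  left_inv c := Subtype.ext (θ.prevFun_nextFun c.2)
  right_inv c := Subtype.ext (θ.nextFun_prevFun c.2)

open Classical in
/-- The next corner in clockwise order around the same vertex. -/
def nextAround (θ : LabeledTree) (c : θ.Corner) : θ.Corner :=
  if h : θ.IsCorner (c.1.1, c.1.2 + 1) then ⟨(c.1.1, c.1.2 + 1), h⟩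
  else ⟨(c.1.1, 0), c.2.1, Nat.zero_le _, fun hu => Nat.zero_lt_of_lt (c.2.2.2 hu)⟩

/-! ### The Schaeffer map -/

open Classical in
/-- The successor of `c`: the first corner after `c` in the contour order with label
`label c - 1`. If there is none, the successor is the extra element `∂ = none`. -/
def succ (θ : LabeledTree) (c : θ.Corner) : Option θ.Corner :=
  if h : ∃ n, 0 < n ∧ θ.cornerLabel ((θ.contour ^ n) c) = θ.cornerLabel c - 1 then
    some ((θ.contour ^ Nat.find h) c) else none

/-- The corner that is `n` steps before `c` in the contour order. -/
def back (θ : LabeledTree) (n : ℕ) (c : θ.Corner) : θ.Corner := (θ.contour⁻¹ ^ n) c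

/-- The arc of the corner `c` joins `c` to its successor, or to the extra vertex `ρ` if the
successor is `∂`. It gives the dart `(c, true)`, from `c` to the successor, and the reversed dart
`(c, false)`. -/
abbrev ArcDart (θ : LabeledTree) : Type := θ.Corner × Bool

open Classical in
/-- The first dart in clockwise order inside the corner `c`. The darts inside `c` are, in
clockwise order, those of the arcs that arrive at `c`, from the closest to the farthest corner
before `c` whose successor is `c`, followed by the dart of the arc that leaves `c`. -/
def firstDart (θ : LabeledTree) (c : θ.Corner) : θ.ArcDart :=
  if h : ∃ n, 0 < n ∧ θ.succ (θ.back n c) = some c then (θ.back (Nat.find h) c, false)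
  else (c, true)

open Classical in
/-- The clockwise rotation of the darts around their origins.

After the dart that leaves `c` along its own arc comes the first dart of the next corner around
the same vertex.

After the dart that leaves the successor of `c` along the arc of `c` comes the reversed dart of
the next farther arc with the same end: its corner is the first one before `c` in the contour
order with the same successor. If the end of the arc is met before any such corner, then there is
no such arc in this corner, and the next dart is the one that leaves the end along its own arc.
For the arcs that end at `ρ` this is the clockwise cyclic order around `ρ`. -/
def arcRot (θ : LabeledTree) : θ.ArcDart → θ.ArcDart
  | (c, true) => θ.firstDart (θ.nextAround c)
  | (c, false) =>
    if h : ∃ n, 0 < n ∧ θ.succ (θ.back n c) = θ.succ c ∧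
        ∀ i, 0 < i → i < n → some (θ.back i c) ≠ θ.succ c then
      (θ.back (Nat.find h) c, false)
    else match θ.succ c with
      | some c' => (c', true)
      | none => (c, false)

/-- The root corner: the corner of the root to the left of the edge to its first child. -/
def rootCorner (θ : LabeledTree) (h : 0 < θ.numChildren []) : θ.Corner :=
  ⟨([], 0), θ.root_mem, Nat.zero_le _, fun _ => h⟩

/-- The map formed by the arcs. Its root edge is the arc of the root corner, oriented from the
root corner to its successor if `η = 0` (`false`), and in the opposite direction if `η = 1`
(`true`). -/
def schaefferMap (θ : LabeledTree) (h : 0 < θ.numChildren []) (η : Bool) : RootedMap where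
  Dart := θ.ArcDart
  rot := θ.arcRot
  rev d := (d.1, !d.2)
  rev_rev d := by simp
  rev_ne d hd := by simpa using congrArg Prod.snd hd
  root := (θ.rootCorner h, !η)

end LabeledTree

end

/-! ### Orbits of maps with periodic points -/

/-! The faces of the Schaeffer map correspond to the edges of the tree. A corner `c` stands for one
side of an edge, and `opp c` for the other side. If the label changes along the edge, the arcs of
its two sides, of the next corner with the larger label and of the successor of that corner bound a
face; if it does not change, the arcs on either side meet in pairs and bound a face as well
(`arcFaceNext_up`, `arcFaceNext_level`). Every dart lies on such a face, so all degrees are 4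
(`minimalPeriod_arcFaceNext`). All that is needed is `Recurrent`: before and after every corner
there is one whose label is not larger. This holds in a finite tree because the contour is cyclic,
and in a tree with a spine because the labels on the spine, which are seen on both sides, are
unbounded below.

The rotation is then injective, because the fourth power of the face permutation is the identity. It
preserves the tree vertex at which a dart starts, and finiteness of the fibres makes its orbits
finite. Following the contour gives connectedness (`rel_origin_contour`). For a finite tree with `n`
vertices there are `n + 1` vertices, `2 (n - 1)` edges and `n - 1` faces, which is Euler's formula.

For one-endedness, the contour is indexed by `ℤ` and the vertices of a ball occupy a bounded window
of positions. Arcs starting to the right of the window run away from it; arcs starting far to the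
left cannot enter it, since they would have to pass over a corner with a label smaller than all
those in the window. Both tails of the contour are therefore connected outside the ball, and a far
vertex of the spine, visited by both, joins them.

For continuity, a finite tree is an isolated point (`eq_of_sameBall_of_finite`). Near a tree with a
spine, only finitely many darts are within a given distance of the root, and the rotation of each
depends on a finite piece of the contour. A nearby tree thus gives a map that is locally isomorphic
(`eventually_isLocalIso`) and has the same ball (`nonempty_ball_iso`). Applied to truncations of the
tree, this also shows that the image lies in the closure of the finite planar quadrangulations. -/

theorem quot_eq_iff_exists_iterate {α : Type*} {f : α → α}
    (hf : ∀ a, a ∈ Function.periodicPts f) {a b : α} :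
    (Quot.mk (fun x y => f x = y) a = Quot.mk (fun x y => f x = y) b) ↔ ∃ n : ℕ, f^[n] a = b := by
  constructor
  · intro h
    rw [Quot.eq] at h
    induction h with
    | rel x y h => exact ⟨1, h⟩
    | refl x => exact ⟨0, rfl⟩
    | symm x y _ ih =>
      obtain ⟨n, rfl⟩ := ih
      obtain ⟨p, hp, hx⟩ := hf x
      -- Since `p * n` is a multiple of the period, `p * n - n` further steps undo the `n` steps.
      refine ⟨p * n - n, ?_⟩
      rw [← Function.iterate_add_apply, Nat.sub_add_cancel (Nat.le_mul_of_pos_left n hp)]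
      exact hx.mul_const n
    | trans x y z _ _ ih ih' =>
      obtain ⟨n, rfl⟩ := ih
      obtain ⟨k, rfl⟩ := ih'
      exact ⟨k + n, Function.iterate_add_apply f k n x⟩
  · rintro ⟨n, rfl⟩
    induction n with
    | zero => rfl
    | succ n ih =>
      rw [ih, Function.iterate_succ_apply']
      exact Quot.sound rfl

theorem finite_setOf_exists_iterate {α : Type*} {f : α → α} {a : α}
    (ha : a ∈ Function.periodicPts f) : {b | ∃ n : ℕ, f^[n] a = b}.Finite := by
  obtain ⟨p, hp, hx⟩ := ha
  refine ((Set.finite_Iio p).image fun n => f^[n] a).subset ?_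
  rintro _ ⟨n, rfl⟩
  exact ⟨n % p, Nat.mod_lt _ hp, hx.iterate_mod_apply n⟩

/-- Two iterates coincide by the pigeonhole principle, and injectivity cancels the smaller one. -/
theorem mem_periodicPts_of_finite {α : Type*} {f : α → α} (hf : Function.Injective f) {s : Set α}
    (hs : s.Finite) (hfs : ∀ a ∈ s, f a ∈ s) {a : α} (ha : a ∈ s) :
    a ∈ Function.periodicPts f := by
  have hmem : ∀ n : ℕ, f^[n] a ∈ s := fun n => by
    induction n with
    | zero => exact ha
    | succ n ih => rw [Function.iterate_succ_apply']; exact hfs _ ih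
  have hinj : ¬ Function.Injective fun n : ℕ => f^[n] a := fun h =>
    Set.infinite_of_injective_forall_mem h hmem hs
  have key : ∀ i j : ℕ, i < j → f^[i] a = f^[j] a → a ∈ Function.periodicPts f := by
    intro i j hij h
    refine ⟨j - i, Nat.sub_pos_of_lt hij, ?_⟩
    refine (hf.iterate i) ?_
    rw [← Function.iterate_add_apply, Nat.add_sub_cancel' hij.le, h]
  simp only [Function.Injective, not_forall] at hinj
  obtain ⟨i, j, h, hne⟩ := hinj
  rcases lt_or_gt_of_ne hne with hij | hij
  · exact key i j hij h
  · exact key j i hij h.symm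

theorem card_eq_mul_card_quot {α : Type*} [Finite α] {f : α → α} {p : ℕ} (hp : 0 < p)
    (hf : ∀ a, Function.minimalPeriod f a = p) :
    Nat.card α = p * Nat.card (Quot fun x y => f x = y) := by
  have hper : ∀ a, a ∈ Function.periodicPts f := fun a =>
    Function.minimalPeriod_pos_iff_mem_periodicPts.1 (by rw [hf]; exact hp)
  set q : α → Quot fun x y => f x = y := Quot.mk _ with hq
  have : Finite (Quot fun x y => f x = y) := Finite.of_surjective q Quot.mk_surjective
  have hfib : ∀ x : Quot fun x y => f x = y, Nat.card {a // q a = x} = p := by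
    rintro ⟨a⟩
    have hset : {b | q b = q a} = (fun n : ℕ => f^[n] a) '' Set.Iio p := by
      ext b
      constructor
      · intro h
        obtain ⟨n, rfl⟩ := (quot_eq_iff_exists_iterate hper).1 (Eq.symm h)
        refine ⟨n % p, Nat.mod_lt _ hp, ?_⟩
        have := Function.iterate_mod_minimalPeriod_eq (f := f) (x := a) (n := n)
        rwa [hf] at this
      · rintro ⟨n, -, rfl⟩
        exact ((quot_eq_iff_exists_iterate hper).2 ⟨n, rfl⟩).symm
    have hcard : Nat.card {b | q b = q a} = p := by
      rw [hset]
      have hinj := Function.iterate_injOn_Iio_minimalPeriod (f := f) (x := a)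
      rw [hf] at hinj
      have := hinj.ncard_image
      rw [Set.ncard_Iio_nat] at this
      exact this
    exact hcard
  rw [Nat.card_congr (Equiv.sigmaFiberEquiv q).symm]
  have := Fintype.ofFinite (Quot fun x y => f x = y)
  rw [Nat.card_sigma]
  simp [hfib, mul_comm]

/-- The period divides 4 but not 2, so comparing opposite points is enough. -/
theorem minimalPeriod_eq_four {α : Type*} {f : α → α} {a b c d : α} (hab : f a = b) (hbc : f b = c)
    (hcd : f c = d) (hda : f d = a) (hac : a ≠ c) : Function.minimalPeriod f a = 4 := by
  have h4 : Function.IsPeriodicPt f 4 a := by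
    change f (f (f (f a))) = a
    rw [hab, hbc, hcd, hda]
  have h2 : ¬ Function.minimalPeriod f a ∣ 2 := by
    rw [← Function.isPeriodicPt_iff_minimalPeriod_dvd]
    intro h
    apply hac
    have h' : f (f a) = a := h
    rw [← h', hab, hbc]
  have hd := h4.minimalPeriod_dvd
  have hle := Nat.le_of_dvd (by norm_num) hd
  generalize Function.minimalPeriod f a = n at *
  interval_cases n <;> omega

/-! ### Distances from the root and finiteness of balls -/

namespace RootedMap

variable {m m' : RootedMap}

theorem origin_rot (d : m.Dart) : m.origin (m.rot d) = m.origin d :=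
  Eq.symm (Quot.sound (r := fun d d' : m.Dart => m.rot d = d') rfl)

theorem origin_rot_iterate (n : ℕ) (d : m.Dart) : m.origin (m.rot^[n] d) = m.origin d := by
  induction n with
  | zero => rfl
  | succ n ih => rw [Function.iterate_succ_apply', origin_rot, ih]

theorem adj_or_eq (d : m.Dart) :
    m.graph.Adj (m.origin d) (m.origin (m.rev d)) ∨ m.origin d = m.origin (m.rev d) := by
  by_cases h : m.origin d = m.origin (m.rev d)
  · exact Or.inr h
  · refine Or.inl ?_
    rw [graph, SimpleGraph.fromRel_adj]
    exact ⟨h, Or.inl ⟨d, rfl, rfl⟩⟩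

theorem reachable_rev (d : m.Dart) : m.graph.Reachable (m.origin d) (m.origin (m.rev d)) := by
  rcases m.adj_or_eq d with h | h
  · exact h.reachable
  · rw [← h]

theorem rootDist_rot_iterate (n : ℕ) (d : m.Dart) : m.rootDist (m.rot^[n] d) = m.rootDist d := by
  rw [rootDist, origin_rot_iterate, rootDist]

theorem rootDist_rot (d : m.Dart) : m.rootDist (m.rot d) = m.rootDist d :=
  rootDist_rot_iterate 1 d

theorem rootDist_rev_le {d : m.Dart} {k : ℕ} (h : m.rootDist d ≤ k) :
    m.rootDist (m.rev d) ≤ (k + 1 : ℕ) := by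
  have h1 : m.graph.edist (m.origin d) (m.origin (m.rev d)) ≤ 1 :=
    SimpleGraph.edist_le_one_iff_adj_or_eq.2 (m.adj_or_eq d)
  push_cast
  exact SimpleGraph.edist_triangle.trans (add_le_add h h1)

theorem rootDist_faceNext_le {d : m.Dart} {k : ℕ} (h : m.rootDist d ≤ k) :
    m.rootDist (m.faceNext d) ≤ (k + 1 : ℕ) := by
  rw [faceNext, rootDist_rot]
  exact rootDist_rev_le h

theorem rootDist_faceNext_iterate_le {d : m.Dart} {k : ℕ} (h : m.rootDist d ≤ k) (n : ℕ) :
    m.rootDist (m.faceNext^[n] d) ≤ (k + n : ℕ) := by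
  induction n with
  | zero => exact h
  | succ n ih => rw [Function.iterate_succ_apply']; exact rootDist_faceNext_le ih

theorem exists_of_rootDist_le_succ {d : m.Dart} {k : ℕ} (h : m.rootDist d ≤ (k + 1 : ℕ)) :
    m.rootDist d ≤ k ∨ ∃ e, m.rootDist e ≤ k ∧ m.origin (m.rev e) = m.origin d := by
  have hne : m.graph.edist (m.origin m.root) (m.origin d) ≠ ⊤ :=
    ne_top_of_le_ne_top (ENat.natCast_ne_top _) h
  obtain ⟨w, hw⟩ := SimpleGraph.exists_walk_of_edist_ne_top hne
  rw [rootDist, ← hw, Nat.cast_le] at h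
  rw [rootDist, ← hw]
  rcases Nat.lt_or_ge k w.length with hk | hk
  · have hpos : ¬ w.reverse.Nil := by
      rw [← SimpleGraph.Walk.length_eq_zero_iff, SimpleGraph.Walk.length_reverse]
      omega
    refine Or.inr ?_
    obtain ⟨v, hadj, p, hp⟩ := SimpleGraph.Walk.not_nil_iff.1 hpos
    have hlen : p.length + 1 = w.length := by
      rw [← SimpleGraph.Walk.length_reverse w, hp, SimpleGraph.Walk.length_cons]
    have hdist : m.graph.edist (m.origin m.root) v ≤ k := by
      have := SimpleGraph.edist_le p.reverse
      rw [SimpleGraph.Walk.length_reverse] at this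
      exact this.trans (by exact_mod_cast (by omega))
    rw [graph, SimpleGraph.fromRel_adj] at hadj
    rcases hadj.2 with ⟨e, he, he'⟩ | ⟨e, he, he'⟩
    · refine ⟨m.rev e, ?_, ?_⟩
      · rw [rootDist, he']; exact hdist
      · rw [m.rev_rev, he]
    · refine ⟨e, ?_, he'⟩
      rw [rootDist, he]; exact hdist
  · exact Or.inl (by exact_mod_cast hk)

theorem rootDist_le_zero_iff {d : m.Dart} :
    m.rootDist d ≤ (0 : ℕ) ↔ m.origin m.root = m.origin d := by
  rw [Nat.cast_zero, nonpos_iff_eq_zero, rootDist, SimpleGraph.edist_eq_zero_iff]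

theorem rootDist_root_le (k : ℕ) : m.rootDist m.root ≤ k :=
  (rootDist_le_zero_iff.2 rfl).trans (by exact_mod_cast Nat.zero_le k)

theorem origin_eq_iff (hm : ∀ d, d ∈ Function.periodicPts m.rot) {d d' : m.Dart} :
    m.origin d = m.origin d' ↔ ∃ n : ℕ, m.rot^[n] d = d' :=
  quot_eq_iff_exists_iterate hm

theorem finite_origin_eq (hm : ∀ d, d ∈ Function.periodicPts m.rot) (v : m.Vertex) :
    {d | m.origin d = v}.Finite := by
  obtain ⟨d, rfl⟩ := Quot.exists_rep v
  refine (finite_setOf_exists_iterate (hm d)).subset fun d' hd' => ?_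
  exact (origin_eq_iff hm).1 (Eq.symm hd')

theorem finite_rootDist_le (hm : ∀ d, d ∈ Function.periodicPts m.rot) (k : ℕ) :
    {d | m.rootDist d ≤ k}.Finite := by
  induction k with
  | zero =>
    refine (finite_origin_eq hm (m.origin m.root)).subset fun d hd => ?_
    exact (rootDist_le_zero_iff.1 hd).symm
  | succ k ih =>
    refine (ih.union (ih.biUnion fun e _ => finite_origin_eq hm (m.origin (m.rev e)))).subset ?_
    intro d hd
    rcases exists_of_rootDist_le_succ hd with h | ⟨e, he, h⟩
    · exact Or.inl h
    · exact Or.inr (Set.mem_biUnion he h.symm)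

theorem faceNext_iterate_four (hm : ∀ d, Function.minimalPeriod m.faceNext d = 4) (d : m.Dart) :
    m.faceNext^[4] d = d := by
  have := Function.isPeriodicPt_minimalPeriod m.faceNext d
  rwa [hm] at this

theorem nearFace_iff (hm : ∀ d, Function.minimalPeriod m.faceNext d = 4) {r : ℕ} {d : m.Dart} :
    m.NearFace r d ↔ ∃ k < 4, m.rootDist (m.faceNext^[k] d) < r := by
  constructor
  · rintro ⟨k, hk⟩
    refine ⟨k % 4, Nat.mod_lt _ (by norm_num), ?_⟩
    have h4 : Function.IsPeriodicPt m.faceNext 4 d := faceNext_iterate_four hm d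
    rwa [h4.iterate_mod_apply]
  · rintro ⟨k, -, hk⟩
    exact ⟨k, hk⟩

/-- From the near vertex, `4 - k` more steps round the face lead back to `d`, and each step adds at
most 1 to the distance. -/
theorem NearFace.rootDist_le (hm : ∀ d, Function.minimalPeriod m.faceNext d = 4) {r : ℕ}
    {d : m.Dart} (h : m.NearFace r d) : m.rootDist d ≤ (r + 4 : ℕ) := by
  obtain ⟨k, hk, h⟩ := (nearFace_iff hm).1 h
  have h1 := rootDist_faceNext_iterate_le h.le (4 - k)
  rw [← Function.iterate_add_apply, Nat.sub_add_cancel hk.le, faceNext_iterate_four hm] at h1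
  exact h1.trans (by exact_mod_cast (by omega))

theorem InBall.rootDist_le (hm : ∀ d, Function.minimalPeriod m.faceNext d = 4) {r : ℕ}
    {d : m.Dart} (h : m.InBall r d) : m.rootDist d ≤ (r + 5 : ℕ) := by
  rcases h with h | h
  · exact (h.rootDist_le hm).trans (by exact_mod_cast (by omega))
  · have := rootDist_rev_le (h.rootDist_le hm)
    rwa [m.rev_rev] at this

/-! ### Local isomorphisms of maps and equality of balls -/

/-- A map of darts that is, up to the distance `R` from the root vertex, an isomorphism onto its
image. -/
structure IsLocalIso (f : m.Dart → m'.Dart) (R : ℕ) : Prop where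
  root : f m.root = m'.root
  rot : ∀ d, m.rootDist d ≤ R → f (m.rot d) = m'.rot (f d)
  rev : ∀ d, m.rootDist d ≤ R → f (m.rev d) = m'.rev (f d)
  inj : ∀ d d', m.rootDist d ≤ R → m.rootDist d' ≤ R → f d = f d' → d = d'

namespace IsLocalIso

variable {f : m.Dart → m'.Dart} {R : ℕ}

theorem rot_iterate (hf : IsLocalIso f R) {d : m.Dart} (hd : m.rootDist d ≤ R) (n : ℕ) :
    f (m.rot^[n] d) = m'.rot^[n] (f d) := by
  induction n with
  | zero => rfl
  | succ n ih =>
    rw [Function.iterate_succ_apply', Function.iterate_succ_apply', hf.rot, ih]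
    rwa [rootDist_rot_iterate]

theorem rootDist_le (hf : IsLocalIso f R) (hm : ∀ d, d ∈ Function.periodicPts m.rot)
    {k : ℕ} (hk : k ≤ R) {d : m.Dart} (hd : m.rootDist d ≤ k) : m'.rootDist (f d) ≤ k := by
  induction k generalizing d with
  | zero =>
    obtain ⟨n, rfl⟩ := (origin_eq_iff hm).1 (rootDist_le_zero_iff.1 hd)
    rw [hf.rot_iterate (rootDist_root_le R), hf.root, rootDist_rot_iterate]
    exact rootDist_root_le 0
  | succ k ih =>
    rcases exists_of_rootDist_le_succ hd with h | ⟨e, he, h⟩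
    · exact (ih (by omega) h).trans (by exact_mod_cast (by omega))
    · obtain ⟨n, rfl⟩ := (origin_eq_iff hm).1 h
      have heR : m.rootDist e ≤ R := he.trans (by exact_mod_cast (by omega))
      have hrR : m.rootDist (m.rev e) ≤ R :=
        (rootDist_rev_le he).trans (by exact_mod_cast (by omega))
      rw [hf.rot_iterate hrR, rootDist_rot_iterate, hf.rev e heR]
      exact rootDist_rev_le (ih (by omega) he)

/-- Surjectivity onto the ball comes for free: every near dart of `m'` is obtained from the root by
rotations and reversals at small distance, and `f` commutes with these. -/
theorem exists_preimage (hf : IsLocalIso f R) (hm' : ∀ d, d ∈ Function.periodicPts m'.rot)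
    {k : ℕ} (hk : k ≤ R) {d' : m'.Dart} (hd : m'.rootDist d' ≤ k) :
    ∃ d, m.rootDist d ≤ k ∧ f d = d' := by
  induction k generalizing d' with
  | zero =>
    obtain ⟨n, rfl⟩ := (origin_eq_iff hm').1 (rootDist_le_zero_iff.1 hd)
    refine ⟨m.rot^[n] m.root, ?_, ?_⟩
    · rw [rootDist_rot_iterate]
      exact rootDist_root_le 0
    · rw [hf.rot_iterate (rootDist_root_le R), hf.root]
  | succ k ih =>
    rcases exists_of_rootDist_le_succ hd with h | ⟨e', he, h⟩
    · obtain ⟨d, hdk, hfd⟩ := ih (by omega) h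
      exact ⟨d, hdk.trans (by exact_mod_cast (by omega)), hfd⟩
    · obtain ⟨e, hek, rfl⟩ := ih (by omega) he
      obtain ⟨n, rfl⟩ := (origin_eq_iff hm').1 h
      have heR : m.rootDist e ≤ R := hek.trans (by exact_mod_cast (by omega))
      have hrR : m.rootDist (m.rev e) ≤ R :=
        (rootDist_rev_le hek).trans (by exact_mod_cast (by omega))
      refine ⟨m.rot^[n] (m.rev e), ?_, ?_⟩
      · rw [rootDist_rot_iterate]
        exact rootDist_rev_le hek
      · rw [hf.rot_iterate hrR, hf.rev e heR]

theorem rootDist_le_iff (hf : IsLocalIso f R) (hm : ∀ d, d ∈ Function.periodicPts m.rot)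
    (hm' : ∀ d, d ∈ Function.periodicPts m'.rot) {k : ℕ} (hk : k ≤ R) {d : m.Dart}
    (hd : m.rootDist d ≤ R) : m'.rootDist (f d) ≤ k ↔ m.rootDist d ≤ k := by
  refine ⟨fun h => ?_, hf.rootDist_le hm hk⟩
  obtain ⟨e, he, hfe⟩ := hf.exists_preimage hm' hk h
  rwa [← hf.inj e d (he.trans (by exact_mod_cast hk)) hd hfe]

theorem faceNext_iterate (hf : IsLocalIso f R) {k : ℕ} {d : m.Dart} (hd : m.rootDist d ≤ k)
    (n : ℕ) (hn : k + n ≤ R) : f (m.faceNext^[n] d) = m'.faceNext^[n] (f d) := by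
  induction n with
  | zero => rfl
  | succ n ih =>
    have h1 := rootDist_faceNext_iterate_le hd n
    have h2 := rootDist_rev_le h1
    have h1R : k + n ≤ R := by omega
    have h2R : k + n + 1 ≤ R := by omega
    rw [Function.iterate_succ_apply', Function.iterate_succ_apply', ← ih h1R, faceNext,
      faceNext, hf.rot _ (h2.trans (by exact_mod_cast h2R)),
      hf.rev _ (h1.trans (by exact_mod_cast h1R))]

theorem nearFace_iff (hm : m.IsQuadrangulation) (hm' : m'.IsQuadrangulation) {r : ℕ} (hr : 0 < r)
    (hf : IsLocalIso f (r + 20)) {d : m.Dart} (hd : m.rootDist d ≤ (r + 8 : ℕ)) :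
    m'.NearFace r (f d) ↔ m.NearFace r d := by
  rw [RootedMap.nearFace_iff hm.face_degree, RootedMap.nearFace_iff hm'.face_degree]
  refine exists_congr fun k => and_congr_right fun hk => ?_
  -- The strict bound is put into the form of `rootDist_le_iff`.
  have hlt : ∀ x : ℕ∞, x < r ↔ x ≤ (r - 1 : ℕ) := fun x => by
    obtain ⟨s, rfl⟩ : ∃ s, r = s + 1 := ⟨r - 1, by omega⟩
    rw [Nat.add_sub_cancel]
    push_cast
    exact ENat.lt_add_one_iff (ENat.natCast_ne_top s)
  have h1 := rootDist_faceNext_iterate_le hd k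
  rw [hlt, hlt, ← hf.faceNext_iterate hd k (by omega),
    hf.rootDist_le_iff hm.locallyFinite hm'.locallyFinite (by omega)
      (h1.trans (by exact_mod_cast (by omega)))]

theorem inBall_iff (hm : m.IsQuadrangulation) (hm' : m'.IsQuadrangulation) {r : ℕ} (hr : 0 < r)
    (hf : IsLocalIso f (r + 20)) {d : m.Dart} (hd : m.rootDist d ≤ (r + 6 : ℕ)) :
    m'.InBall r (f d) ↔ m.InBall r d := by
  have h1 := rootDist_rev_le hd
  rw [InBall, InBall, ← hf.rev d (hd.trans (by exact_mod_cast (by omega))),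
    nearFace_iff hm hm' hr hf (hd.trans (by exact_mod_cast (by omega))),
    nearFace_iff hm hm' hr hf (h1.trans (by exact_mod_cast (by omega)))]

/-- The margin 20 is ample: a dart of the ball is at distance at most `r + 5`, and testing
membership takes a reversal and at most three steps round a face. The rotation of a ball is a first
return of `rot`, so it is respected because `f` commutes with the iterates of `rot` and preserves
membership. -/
theorem nonempty_ball_iso (hm : m.IsQuadrangulation) (hm' : m'.IsQuadrangulation) {r : ℕ}
    (hr : 0 < r) (hf : IsLocalIso f (r + 20)) : Nonempty (Iso (m.ball r hr) (m'.ball r hr)) := by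
  have hB : ∀ d, m.InBall r d → m.rootDist d ≤ (r + 6 : ℕ) := fun d hd =>
    (hd.rootDist_le hm.face_degree).trans (by exact_mod_cast (by omega))
  have hR : ∀ d, m.InBall r d → m.rootDist d ≤ (r + 20 : ℕ) := fun d hd =>
    (hB d hd).trans (by exact_mod_cast (by omega))
  let g : (m.ball r hr).Dart → (m'.ball r hr).Dart := fun d =>
    ⟨f d.1, (inBall_iff hm hm' hr hf (hB d.1 d.2)).2 d.2⟩
  have hg : Function.Bijective g := by
    constructor
    · intro d d' h
      exact Subtype.ext (hf.inj _ _ (hR _ d.2) (hR _ d'.2) (congrArg Subtype.val h))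
    · rintro ⟨d', hd'⟩
      have h' : m'.rootDist d' ≤ (r + 6 : ℕ) :=
        (hd'.rootDist_le hm'.face_degree).trans (by exact_mod_cast (by omega))
      obtain ⟨d, hd, rfl⟩ := hf.exists_preimage hm'.locallyFinite (by omega) h'
      exact ⟨⟨d, (inBall_iff hm hm' hr hf hd).1 hd'⟩, rfl⟩
  refine ⟨⟨Equiv.ofBijective g hg, ?_, ?_, ?_⟩⟩
  · classical
    rintro ⟨d, hd⟩
    apply Subtype.ext
    have hiff : ∀ n, (0 < n ∧ m'.InBall r (m'.rot^[n] (f d))) ↔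
        (0 < n ∧ m.InBall r (m.rot^[n] d)) := fun n => by
      rw [← hf.rot_iterate (hR d hd), inBall_iff hm hm' hr hf]
      rw [rootDist_rot_iterate]
      exact hB d hd
    change f ((m.ball r hr).rot ⟨d, hd⟩).1 =
      ((m'.ball r hr).rot ⟨f d, (inBall_iff hm hm' hr hf (hB d hd)).2 hd⟩).1
    simp only [RootedMap.ball]
    by_cases h : ∃ n, 0 < n ∧ m.InBall r (m.rot^[n] d)
    · have h' : ∃ n, 0 < n ∧ m'.InBall r (m'.rot^[n] (f d)) := by
        simpa only [hiff] using h
      rw [dif_pos h, dif_pos h']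
      have hn : Nat.find h' = Nat.find h := Nat.find_congr' fun {n} => hiff n
      change f (m.rot^[Nat.find h] d) = m'.rot^[Nat.find h'] (f d)
      rw [hn, hf.rot_iterate (hR d hd)]
    · have h' : ¬ ∃ n, 0 < n ∧ m'.InBall r (m'.rot^[n] (f d)) := by
        simpa only [hiff] using h
      rw [dif_neg h, dif_neg h']
  · rintro ⟨d, hd⟩
    exact Subtype.ext (hf.rev d (hR d hd))
  · exact Subtype.ext hf.root

end IsLocalIso

end RootedMap

noncomputable section

namespace LabeledTree

variable {θ : LabeledTree}

/-! ### The contour and the rotation around the vertices -/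

@[ext]
theorem Corner.ext {c d : θ.Corner} (h : c.1 = d.1) : c = d := Subtype.ext h

/-- The corner number `i` of `u`. -/
def corner (θ : LabeledTree) (u : List ℕ) (i : ℕ) (h : θ.IsCorner (u, i)) : θ.Corner := ⟨(u, i), h⟩

@[simp]
theorem coe_corner {u : List ℕ} {i : ℕ} (h : θ.IsCorner (u, i)) : (θ.corner u i h).1 = (u, i) := rfl

theorem exists_eq_corner (c : θ.Corner) : ∃ (u : List ℕ) (i : ℕ) (h : θ.IsCorner (u, i)),
    c = θ.corner u i h := ⟨c.1.1, c.1.2, c.2, rfl⟩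

theorem coe_nextAround_of_isCorner {c : θ.Corner} (h : θ.IsCorner (c.1.1, c.1.2 + 1)) :
    (θ.nextAround c).1 = (c.1.1, c.1.2 + 1) := by
  have : θ.nextAround c = θ.corner _ _ h := dif_pos h
  rw [this, coe_corner]

theorem coe_nextAround_of_not_isCorner {c : θ.Corner} (h : ¬ θ.IsCorner (c.1.1, c.1.2 + 1)) :
    (θ.nextAround c).1 = (c.1.1, 0) := by
  have : θ.nextAround c = θ.corner c.1.1 0
      ⟨c.2.1, Nat.zero_le _, fun hu => Nat.zero_lt_of_lt (c.2.2.2 hu)⟩ := dif_neg h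
  rw [this]
  rfl

theorem coe_nextAround (c : θ.Corner) : (θ.nextAround c).1 = (c.1.1, c.1.2 + 1) ∨
    ¬ θ.IsCorner (c.1.1, c.1.2 + 1) ∧ (θ.nextAround c).1 = (c.1.1, 0) := by
  by_cases h : θ.IsCorner (c.1.1, c.1.2 + 1)
  · exact Or.inl (coe_nextAround_of_isCorner h)
  · exact Or.inr ⟨h, coe_nextAround_of_not_isCorner h⟩

/-- The vertex of a corner. -/
def Corner.vert (c : θ.Corner) : θ.verts := ⟨c.1.1, c.2.1⟩

theorem cornerLabel_eq (c : θ.Corner) : θ.cornerLabel c = θ.label c.vert := rfl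

theorem vert_nextAround (c : θ.Corner) : (θ.nextAround c).vert = c.vert := by
  apply Subtype.ext
  change (θ.nextAround c).1.1 = c.1.1
  rcases coe_nextAround c with h | ⟨-, h⟩ <;> rw [h]

theorem cornerLabel_nextAround (c : θ.Corner) :
    θ.cornerLabel (θ.nextAround c) = θ.cornerLabel c := by
  rw [cornerLabel_eq, vert_nextAround, cornerLabel_eq]

/-- The corner from which the contour traverses the same edge as from `c`, in the opposite
direction. -/
def opp (θ : LabeledTree) (c : θ.Corner) : θ.Corner := θ.contour⁻¹ (θ.nextAround c)

theorem contour_opp (c : θ.Corner) : θ.contour (θ.opp c) = θ.nextAround c :=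
  Equiv.apply_symm_apply θ.contour _

theorem contour_inv_nextAround (c : θ.Corner) : θ.contour⁻¹ (θ.nextAround c) = θ.opp c := rfl

theorem isCorner_child {u : List ℕ} {i : ℕ} (hi : i < θ.numChildren u) :
    θ.IsCorner (i :: u, θ.numChildren (i :: u)) :=
  ⟨(θ.child_mem_iff u i).2 hi, le_rfl, fun h => by simp at h⟩

theorem isCorner_parent {v : List ℕ} {j : ℕ} (h : j :: v ∈ θ.verts) : θ.IsCorner (v, j) := by
  have hj := (θ.child_mem_iff v j).1 h
  refine ⟨θ.parent_mem v j h, hj.le, fun hv => ?_⟩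
  dsimp only at hv ⊢
  rwa [hv] at hj

theorem coe_opp (c : θ.Corner) : (θ.opp c).1 = θ.prevFun (θ.nextAround c).1 := rfl

theorem opp_of_lt {u : List ℕ} {i : ℕ} (h : θ.IsCorner (u, i)) (hi : i < θ.numChildren u) :
    θ.opp (θ.corner u i h) = θ.corner (i :: u) (θ.numChildren (i :: u)) (isCorner_child hi) := by
  apply Corner.ext
  rw [coe_opp, coe_corner]
  rcases coe_nextAround (θ.corner u i h) with h' | ⟨h', h''⟩
  · rw [h', coe_corner]
    rfl
  · rw [h'', coe_corner]
    rw [coe_corner] at h'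
    -- After a corner that precedes an edge to a child, `nextAround` starts again at 0 only at the
    -- root, which has no corner of number `numChildren []`.
    have hu : u = [] ∧ i + 1 = θ.numChildren [] := by
      by_contra hne
      refine h' ⟨h.1, hi, fun hu => ?_⟩
      dsimp only at hu ⊢
      subst hu
      have : i + 1 ≠ θ.numChildren [] := fun h' => hne ⟨rfl, h'⟩
      omega
    obtain ⟨rfl, hu⟩ := hu
    have hi' : θ.numChildren [] - 1 = i := by omega
    simp only [prevFun, hi']

theorem opp_of_eq {v : List ℕ} {j : ℕ} (h : θ.IsCorner (j :: v, θ.numChildren (j :: v))) :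
    θ.opp (θ.corner _ _ h) = θ.corner v j (isCorner_parent h.1) := by
  apply Corner.ext
  rw [coe_opp, coe_nextAround_of_not_isCorner]
  · rfl
  · intro h'
    have := h'.2.1
    dsimp only [corner] at this
    omega

theorem corner_cases (c : θ.Corner) :
    (∃ (u : List ℕ) (i : ℕ) (h : θ.IsCorner (u, i)), i < θ.numChildren u ∧ c = θ.corner u i h) ∨
    ∃ (v : List ℕ) (j : ℕ) (h : θ.IsCorner (j :: v, θ.numChildren (j :: v))),
      c = θ.corner _ _ h := by
  obtain ⟨u, i, hc, rfl⟩ := exists_eq_corner c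
  rcases hc.2.1.lt_or_eq with h | h
  · exact Or.inl ⟨u, i, hc, h, rfl⟩
  · dsimp only at h
    subst h
    match u, hc with
    | [], hc => exact absurd (hc.2.2 rfl) (lt_irrefl _)
    | j :: v, hc => exact Or.inr ⟨v, j, hc, rfl⟩

theorem opp_opp (c : θ.Corner) : θ.opp (θ.opp c) = c := by
  rcases corner_cases c with ⟨u, i, h, hi, rfl⟩ | ⟨v, j, h, rfl⟩
  · rw [opp_of_lt h hi, opp_of_eq]
  · rw [opp_of_eq, opp_of_lt _ ((θ.child_mem_iff v j).1 h.1)]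

theorem opp_ne (c : θ.Corner) : θ.opp c ≠ c := by
  intro h'
  have h' := congrArg (fun c : θ.Corner => c.1.1.length) h'
  rcases corner_cases c with ⟨u, i, h, hi, rfl⟩ | ⟨v, j, h, rfl⟩
  · rw [opp_of_lt h hi] at h'
    simp at h'
  · rw [opp_of_eq] at h'
    simp at h'

/-- The tree is itself a map whose darts are the corners, with rotation `nextAround` and reversal
`opp`; the contour is its face permutation. -/
theorem contour_eq (c : θ.Corner) : θ.contour c = θ.nextAround (θ.opp c) := by
  rw [← contour_opp, opp_opp]

theorem cornerLabel_contour_eq (c : θ.Corner) :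
    θ.cornerLabel (θ.contour c) = θ.cornerLabel (θ.opp c) := by
  rw [contour_eq, cornerLabel_nextAround]

theorem abs_cornerLabel_opp_sub_le (c : θ.Corner) :
    |θ.cornerLabel (θ.opp c) - θ.cornerLabel c| ≤ 1 := by
  rcases corner_cases c with ⟨u, i, h, hi, rfl⟩ | ⟨v, j, h, rfl⟩
  · rw [opp_of_lt h hi]
    exact θ.abs_label_sub_le u i ((θ.child_mem_iff _ _).2 hi)
  · rw [opp_of_eq, abs_sub_comm]
    exact θ.abs_label_sub_le v j h.1

theorem abs_cornerLabel_contour_sub_le (c : θ.Corner) :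
    |θ.cornerLabel (θ.contour c) - θ.cornerLabel c| ≤ 1 := by
  rw [cornerLabel_contour_eq]
  exact abs_cornerLabel_opp_sub_le c

/-! ### Iterates of the contour -/

theorem back_eq (n : ℕ) (c : θ.Corner) : θ.back n c = (θ.contour ^ n)⁻¹ c := by
  rw [back, inv_pow]

theorem contour_pow_add (n k : ℕ) (c : θ.Corner) :
    (θ.contour ^ (n + k)) c = (θ.contour ^ n) ((θ.contour ^ k) c) := by
  rw [pow_add, Equiv.Perm.mul_apply]

theorem contour_pow_succ (n : ℕ) (c : θ.Corner) :
    (θ.contour ^ (n + 1)) c = θ.contour ((θ.contour ^ n) c) := by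
  rw [pow_succ', Equiv.Perm.mul_apply]

theorem back_add (n k : ℕ) (c : θ.Corner) : θ.back (n + k) c = θ.back n (θ.back k c) := by
  rw [back, pow_add, Equiv.Perm.mul_apply, back, back]

theorem contour_pow_back (n : ℕ) (c : θ.Corner) : (θ.contour ^ n) (θ.back n c) = c := by
  rw [back_eq]
  exact Equiv.apply_symm_apply (θ.contour ^ n) c

theorem back_contour_pow (n : ℕ) (c : θ.Corner) : θ.back n ((θ.contour ^ n) c) = c := by
  rw [back_eq]
  exact Equiv.symm_apply_apply (θ.contour ^ n) c

theorem contour_pow_back_of_le {k n : ℕ} (h : k ≤ n) (c : θ.Corner) :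
    (θ.contour ^ k) (θ.back n c) = θ.back (n - k) c := by
  obtain ⟨j, rfl⟩ := Nat.exists_eq_add_of_le h
  rw [back_add, contour_pow_back, Nat.add_sub_cancel_left]

theorem contour_pow_back_of_ge {k n : ℕ} (h : n ≤ k) (c : θ.Corner) :
    (θ.contour ^ k) (θ.back n c) = (θ.contour ^ (k - n)) c := by
  conv_lhs => rw [← Nat.sub_add_cancel h, contour_pow_add, contour_pow_back]

theorem back_contour_pow_of_le {k n : ℕ} (h : k ≤ n) (c : θ.Corner) :
    θ.back k ((θ.contour ^ n) c) = (θ.contour ^ (n - k)) c := by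
  conv_lhs => rw [← Nat.add_sub_cancel' h, contour_pow_add, back_contour_pow]

theorem back_one (c : θ.Corner) : θ.back 1 c = θ.contour⁻¹ c := by
  rw [back, pow_one]

theorem back_zero (c : θ.Corner) : θ.back 0 c = c := rfl

theorem contour_inv_contour (c : θ.Corner) : θ.contour⁻¹ (θ.contour c) = c :=
  Equiv.symm_apply_apply θ.contour _

theorem contour_contour_inv (c : θ.Corner) : θ.contour (θ.contour⁻¹ c) = c :=
  Equiv.apply_symm_apply θ.contour _

/-- A function on `ℕ` that decreases by at most 1 at each step takes the values in between. -/
theorem _root_.exists_first_eq {f : ℕ → ℤ} (hf : ∀ n, f n - 1 ≤ f (n + 1)) {a : ℤ} (h0 : a ≤ f 0)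
    {n : ℕ} (hn : f n ≤ a) : ∃ k ≤ n, f k = a ∧ ∀ i < k, a < f i := by
  classical
  have hex : ∃ k, f k ≤ a := ⟨n, hn⟩
  refine ⟨Nat.find hex, Nat.find_min' hex hn, ?_, fun i hi => not_le.1 (Nat.find_min hex hi)⟩
  refine le_antisymm (Nat.find_spec hex) ?_
  rcases h : Nat.find hex with _ | k
  · exact h0
  · have h1 := Nat.find_min hex (m := k) (by omega)
    have h2 := hf k
    omega

theorem cornerLabel_contour_pow_ge (c : θ.Corner) (n : ℕ) :
    θ.cornerLabel ((θ.contour ^ n) c) - 1 ≤ θ.cornerLabel ((θ.contour ^ (n + 1)) c) := by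
  rw [contour_pow_succ]
  have := abs_le.1 (abs_cornerLabel_contour_sub_le ((θ.contour ^ n) c))
  omega

theorem cornerLabel_back_ge (c : θ.Corner) (n : ℕ) :
    θ.cornerLabel (θ.back n c) - 1 ≤ θ.cornerLabel (θ.back (n + 1) c) := by
  have := abs_le.1 (abs_cornerLabel_contour_sub_le (θ.back (n + 1) c))
  rw [add_comm, back_add, back_one, contour_contour_inv] at *
  omega

/-! ### Successors -/

/-- The corner that is `n` steps after `c` is the first one after `c` whose label is less than the
label of `c`. -/
def Hits (θ : LabeledTree) (c d : θ.Corner) (n : ℕ) : Prop :=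
  0 < n ∧ (θ.contour ^ n) c = d ∧ θ.cornerLabel d = θ.cornerLabel c - 1 ∧
    ∀ i < n, θ.cornerLabel c ≤ θ.cornerLabel ((θ.contour ^ i) c)

/-- Labels drop by at most 1 per step, so the first corner with label `ℓ(c) - 1` is also the first
one with label below `ℓ(c)`. Hence an arc never passes over a label smaller than that of its start,
which is the property used in all later arguments. -/
theorem succ_eq_some_iff {c d : θ.Corner} : θ.succ c = some d ↔ ∃ n, θ.Hits c d n := by
  classical
  unfold succ
  constructor
  · intro h
    split_ifs at h with hex
    have h' : (θ.contour ^ Nat.find hex) c = d := by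
      simpa using h
    obtain ⟨h1, h2⟩ := Nat.find_spec hex
    refine ⟨Nat.find hex, h1, h', by rw [← h', h2], fun i hi => ?_⟩
    by_contra! hlt
    obtain ⟨k, hk, hk', -⟩ := exists_first_eq (cornerLabel_contour_pow_ge c)
      (a := θ.cornerLabel c - 1) (n := i) (by simp) (by omega)
    have h0 : 0 < k := by
      rcases Nat.eq_zero_or_pos k with rfl | h0
      · rw [pow_zero, Equiv.Perm.one_apply] at hk'
        omega
      · exact h0
    exact Nat.find_min hex (hk.trans_lt hi) ⟨h0, hk'⟩
  · rintro ⟨n, hn, rfl, hl, hi⟩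
    have hex : ∃ n, 0 < n ∧ θ.cornerLabel ((θ.contour ^ n) c) = θ.cornerLabel c - 1 := ⟨n, hn, hl⟩
    rw [dif_pos hex]
    have : Nat.find hex = n := by
      rw [Nat.find_eq_iff]
      refine ⟨⟨hn, hl⟩, fun k hk h => ?_⟩
      have := hi k hk
      omega
    rw [this]

theorem succ_eq_none_iff {c : θ.Corner} :
    θ.succ c = none ↔ ∀ n, θ.cornerLabel c ≤ θ.cornerLabel ((θ.contour ^ n) c) := by
  constructor
  · intro h n
    by_contra! hlt
    obtain ⟨k, hk, hk', hlt'⟩ := exists_first_eq (cornerLabel_contour_pow_ge c)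
      (a := θ.cornerLabel c - 1) (n := n) (by simp) (by omega)
    have h0 : 0 < k := by
      rcases Nat.eq_zero_or_pos k with rfl | h0
      · rw [pow_zero, Equiv.Perm.one_apply] at hk'
        omega
      · exact h0
    have : θ.succ c = some ((θ.contour ^ k) c) :=
      succ_eq_some_iff.2 ⟨k, h0, rfl, hk', fun i hi => by have := hlt' i hi; omega⟩
    rw [h] at this
    cases this
  · intro h
    rcases hs : θ.succ c with _ | d
    · rfl
    · obtain ⟨n, -, rfl, hl, -⟩ := succ_eq_some_iff.1 hs
      have := h n
      omega

theorem cornerLabel_succ {c d : θ.Corner} (h : θ.succ c = some d) :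
    θ.cornerLabel d = θ.cornerLabel c - 1 := by
  obtain ⟨n, -, -, hl, -⟩ := succ_eq_some_iff.1 h
  exact hl

/-- Nothing between the two corners is lower than they are, so both wait for the same corner. -/
theorem succ_contour_pow {c : θ.Corner} {n : ℕ}
    (hn : θ.cornerLabel ((θ.contour ^ n) c) = θ.cornerLabel c)
    (hi : ∀ i < n, θ.cornerLabel c ≤ θ.cornerLabel ((θ.contour ^ i) c)) :
    θ.succ c = θ.succ ((θ.contour ^ n) c) := by
  rcases h : θ.succ ((θ.contour ^ n) c) with _ | d
  · rw [succ_eq_none_iff] at h ⊢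
    intro k
    rcases lt_or_ge k n with hk | hk
    · exact hi k hk
    · have := h (k - n)
      rwa [← contour_pow_add, Nat.sub_add_cancel hk, hn] at this
  · obtain ⟨k, hk, hd, hl, hk'⟩ := succ_eq_some_iff.1 h
    refine succ_eq_some_iff.2 ⟨k + n, by omega, ?_, by rw [hl, hn], fun i hin => ?_⟩
    · rw [contour_pow_add, hd]
    · rcases lt_or_ge i n with hik | hik
      · exact hi i hik
      · have := hk' (i - n) (by omega)
        rwa [← contour_pow_add, Nat.sub_add_cancel hik, hn] at this

theorem succ_eq_contour {c : θ.Corner}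
    (h : θ.cornerLabel (θ.contour c) = θ.cornerLabel c - 1) : θ.succ c = some (θ.contour c) :=
  succ_eq_some_iff.2 ⟨1, one_pos, by rw [pow_one], h, fun i hi => by
    obtain rfl : i = 0 := by omega
    rfl⟩

/-! ### The rotation of the arcs -/

theorem firstDart_of_eq_add_one {c : θ.Corner}
    (h : θ.cornerLabel (θ.contour⁻¹ c) = θ.cornerLabel c + 1) :
    θ.firstDart c = (θ.contour⁻¹ c, false) := by
  classical
  have hs : θ.succ (θ.back 1 c) = some c := by
    rw [back_one]
    have := succ_eq_contour (c := θ.contour⁻¹ c)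
    rw [contour_contour_inv] at this
    exact this (by omega)
  unfold firstDart
  have hex : ∃ n, 0 < n ∧ θ.succ (θ.back n c) = some c := ⟨1, one_pos, hs⟩
  rw [dif_pos hex]
  have : Nat.find hex = 1 := by
    rw [Nat.find_eq_iff]
    exact ⟨⟨one_pos, hs⟩, fun k hk h => by omega⟩
  rw [this, back_one]

/-- An arc that ends at `c` starts at or passes over the preceding corner, whose label would then be
at least `ℓ(c) + 1`. -/
theorem firstDart_of_le {c : θ.Corner} (h : θ.cornerLabel (θ.contour⁻¹ c) ≤ θ.cornerLabel c) :
    θ.firstDart c = (c, true) := by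
  unfold firstDart
  rw [dif_neg]
  rintro ⟨n, -, hs⟩
  obtain ⟨k, hk, hc, hl, hi⟩ := succ_eq_some_iff.1 hs
  have := hi (k - 1) (by omega)
  have h' : (θ.contour ^ (k - 1)) (θ.back n c) = θ.contour⁻¹ c := by
    rw [Equiv.Perm.eq_inv_iff_eq, ← contour_pow_succ, Nat.sub_add_cancel hk, hc]
  rw [h'] at this
  omega

/-- The corners strictly in between have labels that are too large both to be the common end of the
arcs and to share that end. -/
theorem arcRot_false_of_eq {c : θ.Corner} {n : ℕ} (hn : 0 < n)
    (hl : θ.cornerLabel (θ.back n c) = θ.cornerLabel c)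
    (hi : ∀ i, 0 < i → i < n → θ.cornerLabel c < θ.cornerLabel (θ.back i c)) :
    θ.arcRot (c, false) = (θ.back n c, false) := by
  classical
  have hn' : 0 < n ∧ θ.succ (θ.back n c) = θ.succ c ∧
      ∀ i, 0 < i → i < n → some (θ.back i c) ≠ θ.succ c := by
    refine ⟨hn, ?_, fun i h0 hin h => ?_⟩
    · have := succ_contour_pow (c := θ.back n c) (n := n)
      rw [contour_pow_back] at this
      refine this hl.symm fun i hin => ?_
      rw [contour_pow_back_of_le hin.le]
      rcases Nat.eq_zero_or_pos i with rfl | h0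
      · rw [Nat.sub_zero]
      · rw [hl]
        exact (hi (n - i) (by omega) (by omega)).le
    · have := cornerLabel_succ h.symm
      have := hi i h0 hin
      omega
  unfold arcRot
  dsimp only
  have hex : ∃ n, 0 < n ∧ θ.succ (θ.back n c) = θ.succ c ∧
      ∀ i, 0 < i → i < n → some (θ.back i c) ≠ θ.succ c := ⟨n, hn'⟩
  rw [dif_pos hex]
  have : Nat.find hex = n := by
    rw [Nat.find_eq_iff]
    refine ⟨hn', fun k hk h => ?_⟩
    obtain ⟨hk0, hs, -⟩ := h
    have hlt := hi k hk0 hk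
    rcases hc : θ.succ c with _ | d
    · rw [hc, succ_eq_none_iff] at hs
      have := hs k
      rw [contour_pow_back] at this
      omega
    · have h1 := cornerLabel_succ hc
      rw [hc] at hs
      have h2 := cornerLabel_succ hs
      omega
  rw [this]

theorem arcRot_false_of_eq_contour {c : θ.Corner}
    (hl : θ.cornerLabel (θ.contour⁻¹ c) = θ.cornerLabel c) :
    θ.arcRot (c, false) = (θ.contour⁻¹ c, false) := by
  rw [← back_one] at hl ⊢
  exact arcRot_false_of_eq one_pos hl fun i h0 h1 => by omega

theorem arcRot_false_of_eq_sub_one {c s : θ.Corner}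
    (hl : θ.cornerLabel (θ.contour⁻¹ c) = θ.cornerLabel c - 1) (hs : θ.succ c = some s) :
    θ.arcRot (c, false) = (s, true) := by
  unfold arcRot
  dsimp only
  rw [dif_neg]
  · rw [hs]
  · rintro ⟨n, hn, hsn, hi⟩
    rw [hs] at hsn hi
    have h1 := cornerLabel_succ hs
    have h2 := cornerLabel_succ hsn
    obtain ⟨k, hk, hks, -, hki⟩ := succ_eq_some_iff.1 hsn
    -- An arc from `back n c` that reached `c` would pass over the lower corner just before `c`. It
    -- therefore ends strictly between `back n c` and `c`, which can happen in a cyclic contour and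
    -- is excluded by the last clause in `arcRot`.
    have hkn : k < n := by
      by_contra! h
      have := hki (n - 1) (by omega)
      rw [contour_pow_back_of_le (by omega), Nat.sub_sub_self hn, back_one] at this
      omega
    refine hi (n - k) (by omega) (by omega) ?_
    rw [← hks, contour_pow_back_of_le hkn.le]

theorem arcRot_true (c : θ.Corner) : θ.arcRot (c, true) = θ.firstDart (θ.nextAround c) := rfl

theorem arcRot_true_of_eq_add_one {c : θ.Corner}
    (h : θ.cornerLabel (θ.opp c) = θ.cornerLabel c + 1) :
    θ.arcRot (c, true) = (θ.opp c, false) := by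
  rw [arcRot_true, firstDart_of_eq_add_one, contour_inv_nextAround]
  rw [contour_inv_nextAround, cornerLabel_nextAround, h]

theorem arcRot_true_of_le {c : θ.Corner} (h : θ.cornerLabel (θ.opp c) ≤ θ.cornerLabel c) :
    θ.arcRot (c, true) = (θ.nextAround c, true) := by
  rw [arcRot_true, firstDart_of_le]
  rwa [contour_inv_nextAround, cornerLabel_nextAround]

/-! ### The faces -/

/-- After every corner and before every corner comes one whose label is not larger. -/
def Recurrent (θ : LabeledTree) : Prop :=
  ∀ c : θ.Corner, (∃ n, 0 < n ∧ θ.cornerLabel ((θ.contour ^ n) c) ≤ θ.cornerLabel c) ∧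
    ∃ n, 0 < n ∧ θ.cornerLabel (θ.back n c) ≤ θ.cornerLabel c

/-- The next dart along the face to the left, in the Schaeffer map. -/
def arcFaceNext (θ : LabeledTree) (d : θ.ArcDart) : θ.ArcDart := θ.arcRot (d.1, !d.2)

/-- With `ℓ = ℓ(c)`, this is the face around a tree edge with labels `ℓ` and `ℓ + 1`: the arc of
`opp c` comes back to the vertex of `c`, that of `θ.contour c` goes to `s`, and those of `s` and `c`
have the same end, with label `ℓ - 1` (or `ρ`). -/
theorem arcFaceNext_up (hθ : θ.Recurrent) {c : θ.Corner}
    (h : θ.cornerLabel (θ.contour c) = θ.cornerLabel c + 1) :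
    ∃ s, θ.succ (θ.contour c) = some s ∧ θ.arcFaceNext (c, false) = (θ.opp c, false) ∧
      θ.arcFaceNext (θ.opp c, false) = (θ.contour c, true) ∧
      θ.arcFaceNext (θ.contour c, true) = (s, true) ∧ θ.arcFaceNext (s, true) = (c, false) := by
  obtain ⟨n, hn, hlt⟩ := (hθ c).1
  have hc : ∀ i, (θ.contour ^ i) (θ.contour c) = (θ.contour ^ (i + 1)) c := fun i => by
    rw [contour_pow_add, pow_one]
  have hsome : θ.succ (θ.contour c) ≠ none := by
    rw [ne_eq, succ_eq_none_iff]
    intro h'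
    have := h' (n - 1)
    rw [hc, Nat.sub_add_cancel hn] at this
    omega
  obtain ⟨s, hs⟩ := Option.ne_none_iff_exists'.1 hsome
  refine ⟨s, hs, ?_, ?_, ?_, ?_⟩
  · refine arcRot_true_of_eq_add_one ?_
    rw [← cornerLabel_contour_eq, h]
  · have := arcRot_true_of_le (c := θ.opp c)
    rw [opp_opp, ← contour_eq] at this
    refine this ?_
    rw [← cornerLabel_contour_eq, h]
    omega
  · refine arcRot_false_of_eq_sub_one ?_ hs
    rw [contour_inv_contour, h]
    omega
  -- Going back from `s`, all labels are larger until `c`, so the arc of `c` is the next one around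
  -- their common end.
  · obtain ⟨k, hk, rfl, hl, hi⟩ := succ_eq_some_iff.1 hs
    rw [hc] at hl
    have := arcRot_false_of_eq (c := (θ.contour ^ k) (θ.contour c)) (n := k + 1) (by omega)
    rw [hc, back_contour_pow] at this
    rw [hc]
    refine this (by omega) fun i h0 hik => ?_
    rw [back_contour_pow_of_le hik.le]
    have := hi (k - i) (by omega)
    rw [hc, show k - i + 1 = k + 1 - i by omega] at this
    omega

/-- This is half of the face around an edge with equal labels; the other half is the same statement
for `opp c`. -/
theorem arcFaceNext_level {c : θ.Corner}
    (h : θ.cornerLabel (θ.contour c) = θ.cornerLabel c) :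
    θ.arcFaceNext (c, false) = (θ.nextAround c, true) ∧
      θ.arcFaceNext (θ.nextAround c, true) = (θ.opp c, false) := by
  rw [cornerLabel_contour_eq] at h
  refine ⟨arcRot_true_of_le h.le, ?_⟩
  have := arcRot_false_of_eq_contour (c := θ.nextAround c)
  rw [contour_inv_nextAround, cornerLabel_nextAround] at this
  exact this h

theorem minimalPeriod_arcFaceNext (hθ : θ.Recurrent) (d : θ.ArcDart) :
    Function.minimalPeriod θ.arcFaceNext d = 4 := by
  have hup : ∀ c : θ.Corner, θ.cornerLabel (θ.contour c) = θ.cornerLabel c + 1 →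
      ∃ s, θ.succ (θ.contour c) = some s ∧ Function.minimalPeriod θ.arcFaceNext (c, false) = 4 ∧
        Function.minimalPeriod θ.arcFaceNext (θ.opp c, false) = 4 ∧
        Function.minimalPeriod θ.arcFaceNext (θ.contour c, true) = 4 ∧
        Function.minimalPeriod θ.arcFaceNext (s, true) = 4 := by
    intro c h
    obtain ⟨s, hs, h1, h2, h3, h4⟩ := arcFaceNext_up hθ h
    exact ⟨s, hs, minimalPeriod_eq_four h1 h2 h3 h4 (by simp),
      minimalPeriod_eq_four h2 h3 h4 h1 (by simp), minimalPeriod_eq_four h3 h4 h1 h2 (by simp),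
      minimalPeriod_eq_four h4 h1 h2 h3 (by simp)⟩
  have hlevel : ∀ c : θ.Corner, θ.cornerLabel (θ.contour c) = θ.cornerLabel c →
      Function.minimalPeriod θ.arcFaceNext (c, false) = 4 ∧
        Function.minimalPeriod θ.arcFaceNext (θ.contour c, true) = 4 := by
    intro c h
    obtain ⟨h1, h2⟩ := arcFaceNext_level h
    have h' : θ.cornerLabel (θ.contour (θ.opp c)) = θ.cornerLabel (θ.opp c) := by
      rw [cornerLabel_contour_eq, opp_opp, ← cornerLabel_contour_eq, h]
    obtain ⟨h3, h4⟩ := arcFaceNext_level h'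
    rw [← contour_eq] at h3 h4
    rw [opp_opp] at h4
    refine ⟨minimalPeriod_eq_four h1 h2 h3 h4 ?_, minimalPeriod_eq_four h4 h1 h2 h3 ?_⟩
    · intro h
      exact opp_ne c (congrArg Prod.fst h).symm
    · intro h
      have h := congrArg Prod.fst h
      dsimp only at h
      rw [← contour_opp] at h
      exact opp_ne c (θ.contour.injective h).symm
  obtain ⟨x, b⟩ := d
  cases b
  · have habs := abs_le.1 (abs_cornerLabel_contour_sub_le x)
    obtain h | h | h : θ.cornerLabel (θ.contour x) = θ.cornerLabel x + 1 ∨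
        θ.cornerLabel (θ.contour x) = θ.cornerLabel x ∨
        θ.cornerLabel (θ.contour x) = θ.cornerLabel x - 1 := by omega
    · obtain ⟨s, -, h, -⟩ := hup x h
      exact h
    · exact (hlevel x h).1
    · obtain ⟨s, -, -, h, -⟩ := hup (θ.opp x) (by
        rw [cornerLabel_contour_eq, opp_opp, ← cornerLabel_contour_eq, h]; omega)
      rwa [opp_opp] at h
  · have habs := abs_le.1 (abs_cornerLabel_contour_sub_le (θ.contour⁻¹ x))
    rw [contour_contour_inv] at habs
    obtain h | h | h : θ.cornerLabel x = θ.cornerLabel (θ.contour⁻¹ x) + 1 ∨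
        θ.cornerLabel x = θ.cornerLabel (θ.contour⁻¹ x) ∨
        θ.cornerLabel x = θ.cornerLabel (θ.contour⁻¹ x) - 1 := by omega
    · have := hup (θ.contour⁻¹ x)
      rw [contour_contour_inv] at this
      obtain ⟨s, -, -, -, h, -⟩ := this h
      exact h
    · have := hlevel (θ.contour⁻¹ x)
      rw [contour_contour_inv] at this
      exact (this h).2
    -- Here `x` is the corner `s` of a face of `arcFaceNext_up`. The corner `c` of that face is the
    -- last one before `x` whose label is at most `ℓ(x)`; the backward half of recurrence provides
    -- it.
    · obtain ⟨n, hn, hle⟩ := (hθ x).2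
      obtain ⟨k, hk, hl, hi⟩ := exists_first_eq (f := fun i => θ.cornerLabel (θ.back (i + 1) x))
        (fun i => cornerLabel_back_ge x (i + 1)) (a := θ.cornerLabel x) (n := n - 1)
        (by rw [back_one]; omega) (by rwa [Nat.sub_add_cancel hn])
      have hk0 : 0 < k := by
        rcases Nat.eq_zero_or_pos k with rfl | h0
        · rw [back_one] at hl
          omega
        · exact h0
      have hc : θ.contour (θ.back (k + 1) x) = θ.back k x := by
        have := contour_pow_back_of_le (k := 1) (n := k + 1) (by omega) x
        rwa [pow_one, Nat.add_sub_cancel] at this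
      have h1 := abs_le.1 (abs_cornerLabel_contour_sub_le (θ.back (k + 1) x))
      have h2 := hi (k - 1) (by omega)
      rw [Nat.sub_add_cancel hk0] at h2
      rw [hc] at h1
      obtain ⟨s, hs, -, -, -, h⟩ := hup (θ.back (k + 1) x) (by rw [hc]; omega)
      rw [hc] at hs
      have hx : θ.succ (θ.back k x) = some x := by
        refine succ_eq_some_iff.2 ⟨k, hk0, contour_pow_back k x, by omega, fun i hik => ?_⟩
        rw [contour_pow_back_of_le hik.le]
        have := hi (k - i - 1) (by omega)
        rw [show k - i - 1 + 1 = k - i by omega] at this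
        omega
      rw [hx] at hs
      cases hs
      exact h

/-! ### The vertices of the Schaeffer map -/

theorem iterate_arcFaceNext_four (hθ : θ.Recurrent) (d : θ.ArcDart) :
    θ.arcFaceNext (θ.arcFaceNext (θ.arcFaceNext (θ.arcFaceNext d))) = d := by
  have := Function.isPeriodicPt_minimalPeriod θ.arcFaceNext d
  rwa [minimalPeriod_arcFaceNext hθ] at this

/-- The rotation is the face permutation composed with the reversal, and the former has its third
iterate as a left inverse. -/
theorem arcRot_injective (hθ : θ.Recurrent) : Function.Injective θ.arcRot := by
  have hinj : Function.Injective θ.arcFaceNext :=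
    Function.LeftInverse.injective (g := fun d => θ.arcFaceNext (θ.arcFaceNext (θ.arcFaceNext d)))
      (iterate_arcFaceNext_four hθ)
  intro d d' h
  have h1 : ∀ d, θ.arcFaceNext (d.1, !d.2) = θ.arcRot d := fun d => by
    simp [arcFaceNext]
  have := hinj (a₁ := (d.1, !d.2)) (a₂ := (d'.1, !d'.2)) (by rw [h1, h1, h])
  simpa [Prod.ext_iff] using this

/-- The vertex of the tree at which a dart starts; it is `none` for the extra vertex. -/
def arcVert (θ : LabeledTree) : θ.ArcDart → Option θ.verts
  | (c, true) => some c.vert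
  | (c, false) => (θ.succ c).map Corner.vert

theorem succ_opp_of_eq_add_one {c : θ.Corner}
    (h : θ.cornerLabel (θ.opp c) = θ.cornerLabel c + 1) :
    θ.succ (θ.opp c) = some (θ.nextAround c) := by
  rw [← contour_opp]
  refine succ_eq_contour ?_
  rw [contour_opp, cornerLabel_nextAround, h]
  omega

theorem arcRot_true_cases (c : θ.Corner) : θ.arcRot (c, true) = (θ.nextAround c, true) ∨
    θ.arcRot (c, true) = (θ.opp c, false) ∧ θ.succ (θ.opp c) = some (θ.nextAround c) := by
  have := abs_le.1 (abs_cornerLabel_opp_sub_le c)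
  rcases lt_or_ge (θ.cornerLabel c) (θ.cornerLabel (θ.opp c)) with h | h
  · have h' : θ.cornerLabel (θ.opp c) = θ.cornerLabel c + 1 := by omega
    exact Or.inr ⟨arcRot_true_of_eq_add_one h', succ_opp_of_eq_add_one h'⟩
  · exact Or.inl (arcRot_true_of_le h)

theorem arcRot_false_cases (c : θ.Corner) :
    (∃ n, 0 < n ∧ θ.arcRot (c, false) = (θ.back n c, false) ∧ θ.succ (θ.back n c) = θ.succ c ∧
      ∀ i, 0 < i → i < n → some (θ.back i c) ≠ θ.succ c ∧ θ.succ (θ.back i c) ≠ θ.succ c) ∨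
    (∃ s, θ.succ c = some s ∧ θ.arcRot (c, false) = (s, true)) ∨
    (θ.succ c = none ∧ ∀ n, 0 < n → θ.succ (θ.back n c) ≠ none) := by
  classical
  by_cases h : ∃ n, 0 < n ∧ θ.succ (θ.back n c) = θ.succ c ∧
      ∀ i, 0 < i → i < n → some (θ.back i c) ≠ θ.succ c
  · have hr : θ.arcRot (c, false) = (θ.back (Nat.find h) c, false) := by
      unfold arcRot
      dsimp only
      rw [dif_pos h]
    obtain ⟨h1, h2, h3⟩ := Nat.find_spec h
    refine Or.inl ⟨_, h1, hr, h2, fun i h0 hi => ⟨h3 i h0 hi, fun hs => ?_⟩⟩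
    exact Nat.find_min h hi ⟨h0, hs, fun j hj0 hj => h3 j hj0 (hj.trans hi)⟩
  · rcases hs : θ.succ c with _ | s
    · refine Or.inr (Or.inr ⟨rfl, fun n hn hn' => h ⟨n, hn, by rw [hs, hn'], fun i _ _ => ?_⟩⟩)
      rw [hs]
      exact Option.some_ne_none _
    · refine Or.inr (Or.inl ⟨s, rfl, ?_⟩)
      unfold arcRot
      dsimp only
      rw [dif_neg h, hs]

theorem arcVert_arcRot (d : θ.ArcDart) : θ.arcVert (θ.arcRot d) = θ.arcVert d := by
  obtain ⟨c, b⟩ := d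
  cases b
  · unfold arcRot
    dsimp only
    split_ifs with h
    · classical
      exact congrArg (Option.map Corner.vert) (Nat.find_spec h).2.1
    · rcases hs : θ.succ c with _ | s
      · rfl
      · change some s.vert = (θ.succ c).map Corner.vert
        rw [hs]
        rfl
  · rcases arcRot_true_cases c with h | ⟨h, h'⟩
    · rw [h]
      exact congrArg some (vert_nextAround c)
    · rw [h]
      change (θ.succ (θ.opp c)).map Corner.vert = some c.vert
      rw [h', Option.map_some, vert_nextAround]

/-- A corner before `c` whose label is at most `ℓ(c)` shields `c` from all arcs that start there or
earlier. -/
theorem Hits.lt {b c : θ.Corner} {n k : ℕ} (h : θ.Hits b c n) (hk : 0 < k)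
    (hle : θ.cornerLabel (θ.back k c) ≤ θ.cornerLabel c) : n < k := by
  obtain ⟨hn, rfl, hl, hi⟩ := h
  by_contra! hkn
  rw [back_contour_pow_of_le hkn] at hle
  have := hi (n - k) (by omega)
  omega

theorem finite_setOf_vert_eq (u : θ.verts) : {c : θ.Corner | c.vert = u}.Finite := by
  refine Set.Finite.of_injOn (f := fun c : θ.Corner => c.1.2) (t := Set.Iic (θ.numChildren u.1)) ?_
    ?_ (Set.finite_Iic _)
  · rintro c rfl
    exact c.2.2.1
  · rintro c rfl d hd h
    apply Corner.ext
    exact Prod.ext (congrArg Subtype.val hd).symm h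

theorem finite_setOf_succ_eq (hθ : θ.Recurrent) (c : θ.Corner) :
    {b | θ.succ b = some c}.Finite := by
  obtain ⟨k, hk, hle⟩ := (hθ c).2
  refine ((Set.finite_Iio k).image fun n => θ.back n c).subset fun b hb => ?_
  obtain ⟨n, hn⟩ := succ_eq_some_iff.1 hb
  refine ⟨n, hn.lt hk hle, ?_⟩
  obtain ⟨-, rfl, -⟩ := hn
  exact back_contour_pow n b

theorem finite_setOf_arcVert_eq (hθ : θ.Recurrent) (u : θ.verts) :
    {d | θ.arcVert d = some u}.Finite := by
  have hf := finite_setOf_vert_eq u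
  refine ((hf.image fun c => (c, true)).union
    ((hf.biUnion fun c _ => finite_setOf_succ_eq hθ c).image fun c => (c, false))).subset ?_
  rintro ⟨c, b⟩ h
  cases b
  · change (θ.succ c).map Corner.vert = some u at h
    rw [Option.map_eq_some_iff] at h
    obtain ⟨s, hs, hu⟩ := h
    exact Or.inr ⟨c, Set.mem_biUnion hu hs, rfl⟩
  · exact Or.inl ⟨c, Option.some_injective _ h, rfl⟩

/-- An orbit stays in a fibre of `arcVert`. The fibre of a tree vertex is always finite; that of `ρ`
is controlled only if it is empty or there are finitely many corners. -/
theorem mem_periodicPts_arcRot (hθ : θ.Recurrent)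
    (hfin : (∀ c, θ.succ c ≠ none) ∨ Finite θ.Corner) (d : θ.ArcDart) :
    d ∈ Function.periodicPts θ.arcRot := by
  refine mem_periodicPts_of_finite (arcRot_injective hθ) (s := {d' | θ.arcVert d' = θ.arcVert d})
    ?_ (fun d' h => (arcVert_arcRot d').trans h) rfl
  rcases hfin with hs | hfin
  · have hne : θ.arcVert d ≠ none := by
      obtain ⟨c, b⟩ := d
      cases b
      · change (θ.succ c).map Corner.vert ≠ none
        rw [ne_eq, Option.map_eq_none_iff]
        exact hs c
      · exact Option.some_ne_none _
    obtain ⟨u, hu⟩ := Option.ne_none_iff_exists'.1 hne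
    rw [hu]
    exact finite_setOf_arcVert_eq hθ u
  · exact Set.toFinite _

/-! ### Vertices and connectedness of the Schaeffer map -/

section SchaefferMap

variable (h : 0 < θ.numChildren []) (η : Bool)

theorem origin_arcRot (d : θ.ArcDart) :
    (θ.schaefferMap h η).origin (θ.arcRot d) = (θ.schaefferMap h η).origin d :=
  RootedMap.origin_rot (m := θ.schaefferMap h η) d

/-- Rotating from `(b, false)` runs through ever longer arcs that end at `s`. Their lengths are
bounded by `Hits.lt`, so the rotation finally arrives at `(s, true)`. -/
theorem Hits.origin_eq (hθ : θ.Recurrent) {b s : θ.Corner} {n : ℕ} (hb : θ.Hits b s n) :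
    (θ.schaefferMap h η).origin (b, false) = (θ.schaefferMap h η).origin (s, true) := by
  obtain ⟨k, hk, hle⟩ := (hθ s).2
  induction hj : k - n using Nat.strong_induction_on generalizing b n with
  | _ j ih =>
    subst hj
    have hs := succ_eq_some_iff.2 ⟨n, hb⟩
    have hnk := hb.lt hk hle
    rcases arcRot_false_cases b with ⟨p, hp, hr, hsp, hi⟩ | ⟨s', hs', hr⟩ | ⟨hs', -⟩
    · rw [hs] at hsp hi
      obtain ⟨n', hb'⟩ := succ_eq_some_iff.1 hsp
      -- Otherwise the arc from `back p b` would end before `b`, at `b`, or less than `n` steps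
      -- after `b`; these are excluded by `hi`, by the labels and by `hi1` respectively.
      have hnn : n < n' := by
        obtain ⟨h0, hn', hl', -⟩ := id hb'
        obtain ⟨h1, hn, hl, hi1⟩ := id hb
        by_contra! hle
        rcases lt_trichotomy n' p with hnp | rfl | hnp
        · rw [contour_pow_back_of_le hnp.le] at hn'
          exact (hi (p - n') (by omega) (by omega)).1 (by rw [hn'])
        · rw [contour_pow_back] at hn'
          rw [hn'] at hl
          omega
        · rw [contour_pow_back_of_ge hnp.le] at hn'
          have := hi1 (n' - p) (by omega)
          rw [hn'] at this
          omega
      rw [← origin_arcRot h η (b, false), hr]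
      exact ih (k - n') (by omega) hb' rfl
    · rw [hs] at hs'
      cases hs'
      rw [← origin_arcRot h η (b, false), hr]
    · rw [hs] at hs'
      cases hs'

theorem origin_of_succ_eq (hθ : θ.Recurrent) {b s : θ.Corner} (hs : θ.succ b = some s) :
    (θ.schaefferMap h η).origin (b, false) = (θ.schaefferMap h η).origin (s, true) := by
  obtain ⟨n, hn⟩ := succ_eq_some_iff.1 hs
  exact hn.origin_eq h η hθ

theorem origin_nextAround (hθ : θ.Recurrent) (c : θ.Corner) :
    (θ.schaefferMap h η).origin (θ.nextAround c, true) =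
      (θ.schaefferMap h η).origin (c, true) := by
  rw [← origin_arcRot h η (c, true)]
  rcases arcRot_true_cases c with h' | ⟨h', hs⟩
  · rw [h']
  · rw [h', origin_of_succ_eq h η hθ hs]

theorem origin_eq_of_vert_eq (hθ : θ.Recurrent) {c d : θ.Corner} (hcd : c.vert = d.vert) :
    (θ.schaefferMap h η).origin (c, true) = (θ.schaefferMap h η).origin (d, true) := by
  have key : ∀ (u : List ℕ) (i : ℕ) (hc : θ.IsCorner (u, i)) (h0 : θ.IsCorner (u, 0)),
      (θ.schaefferMap h η).origin (θ.corner u i hc, true) =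
        (θ.schaefferMap h η).origin (θ.corner u 0 h0, true) := by
    intro u i hc h0
    induction i with
    | zero => rfl
    | succ i ih =>
      have hi : θ.IsCorner (u, i) := by
        obtain ⟨h1, h2, h3⟩ := hc
        dsimp only at h1 h2 h3
        exact ⟨h1, by dsimp only; omega, fun h => by have := h3 h; dsimp only; omega⟩
      rw [← ih hi, ← origin_nextAround h η hθ (θ.corner u i hi)]
      congr 2
      apply Corner.ext
      rw [coe_nextAround_of_isCorner (c := θ.corner u i hi) hc]
      rfl
  obtain ⟨u, i, hc, rfl⟩ := exists_eq_corner c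
  obtain ⟨v, j, hd, rfl⟩ := exists_eq_corner d
  obtain rfl : u = v := congrArg Subtype.val hcd
  have h0 : θ.IsCorner (u, 0) :=
    ⟨hc.1, Nat.zero_le _, fun hu => (Nat.zero_le _).trans_lt (hc.2.2 hu)⟩
  rw [key u i hc h0, key u j hd h0]

/-- The vertices of `c` and `θ.contour c` are joined by the arc of `opp c` if the label goes up, by
the two arcs to a common end if it is constant, and by the arc of `c` if it goes down. The set `K`
and the relation `r` are arbitrary in order to serve both for connectedness and for the complement
of a ball. -/
theorem rel_origin_contour (hθ : θ.Recurrent) {K : Set (θ.schaefferMap h η).Vertex}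
    {r : (θ.schaefferMap h η).Vertex → (θ.schaefferMap h η).Vertex → Prop}
    (hsymm : ∀ v w, r v w → r w v) (htrans : ∀ u v w, r u v → r v w → r u w)
    (hadj : ∀ c : θ.Corner, (θ.schaefferMap h η).origin (c, true) ∈ K →
      (θ.schaefferMap h η).origin (c, false) ∈ K →
      r ((θ.schaefferMap h η).origin (c, true)) ((θ.schaefferMap h η).origin (c, false)))
    {c : θ.Corner} (hc : (θ.schaefferMap h η).origin (c, true) ∈ K)
    (hc' : (θ.schaefferMap h η).origin (θ.contour c, true) ∈ K)
    (hs : (θ.schaefferMap h η).origin (c, false) ∈ K) :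
    r ((θ.schaefferMap h η).origin (c, true))
      ((θ.schaefferMap h η).origin (θ.contour c, true)) := by
  have hopp : (θ.schaefferMap h η).origin (θ.opp c, true) =
      (θ.schaefferMap h η).origin (θ.contour c, true) := by
    rw [contour_eq, origin_nextAround h η hθ]
  have habs := abs_le.1 (abs_cornerLabel_contour_sub_le c)
  obtain hl | hl | hl : θ.cornerLabel (θ.contour c) = θ.cornerLabel c + 1 ∨
      θ.cornerLabel (θ.contour c) = θ.cornerLabel c ∨
      θ.cornerLabel (θ.contour c) = θ.cornerLabel c - 1 := by omega
  · have h1 : (θ.schaefferMap h η).origin (θ.opp c, false) =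
        (θ.schaefferMap h η).origin (c, true) := by
      rw [← origin_arcRot h η (c, true), arcRot_true_of_eq_add_one]
      rw [← cornerLabel_contour_eq, hl]
    have := hadj (θ.opp c) (by rwa [hopp]) (by rwa [h1])
    rw [hopp, h1] at this
    exact hsymm _ _ this
  · have h1 : (θ.schaefferMap h η).origin (θ.contour c, false) =
        (θ.schaefferMap h η).origin (c, false) := by
      rw [← origin_arcRot h η (θ.contour c, false), arcRot_false_of_eq_contour,
        contour_inv_contour]
      rw [contour_inv_contour, hl]
    have h2 := hadj (θ.contour c) hc' (by rwa [h1])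
    rw [h1] at h2
    exact htrans _ _ _ (hadj c hc hs) (hsymm _ _ h2)
  · have h1 : (θ.schaefferMap h η).origin (c, false) =
        (θ.schaefferMap h η).origin (θ.contour c, true) := by
      rw [origin_of_succ_eq h η hθ (succ_eq_contour hl)]
    have := hadj c hc hs
    rwa [h1] at this

theorem connected_schaefferMap (hθ : θ.Recurrent)
    (htr : ∀ c, θ.contour.SameCycle (θ.rootCorner h) c) :
    (θ.schaefferMap h η).graph.Connected := by
  have hstep : ∀ c : θ.Corner, (θ.schaefferMap h η).graph.Reachable
      ((θ.schaefferMap h η).origin (c, true))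
      ((θ.schaefferMap h η).origin (θ.contour c, true)) := fun c =>
    rel_origin_contour h η hθ (K := Set.univ) (fun _ _ h => h.symm) (fun _ _ _ h h' => h.trans h')
      (fun c _ _ => RootedMap.reachable_rev (m := θ.schaefferMap h η) (c, true)) trivial trivial
      trivial
  have hpow : ∀ (n : ℕ) (c : θ.Corner), (θ.schaefferMap h η).graph.Reachable
      ((θ.schaefferMap h η).origin (c, true))
      ((θ.schaefferMap h η).origin ((θ.contour ^ n) c, true)) := by
    intro n c
    induction n with
    | zero => rfl
    | succ n ih =>
      rw [contour_pow_succ]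
      exact ih.trans (hstep _)
  have hall : ∀ v : (θ.schaefferMap h η).Vertex, (θ.schaefferMap h η).graph.Reachable
      ((θ.schaefferMap h η).origin (θ.rootCorner h, true)) v := by
    have htrue : ∀ c : θ.Corner, (θ.schaefferMap h η).graph.Reachable
        ((θ.schaefferMap h η).origin (θ.rootCorner h, true))
        ((θ.schaefferMap h η).origin (c, true)) := by
      intro c
      obtain ⟨i, rfl⟩ := htr c
      obtain ⟨n, rfl | rfl⟩ := i.eq_nat_or_neg
      · rw [zpow_natCast]
        exact hpow n _
      · rw [zpow_neg, zpow_natCast, ← back_eq]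
        have := hpow n (θ.back n (θ.rootCorner h))
        rw [contour_pow_back] at this
        exact this.symm
    rintro ⟨⟨c, b⟩⟩
    cases b
    · exact (htrue c).trans (RootedMap.reachable_rev (m := θ.schaefferMap h η) (c, true))
    · exact htrue c
  have : Nonempty (θ.schaefferMap h η).Vertex :=
    ⟨(θ.schaefferMap h η).origin (θ.rootCorner h, true)⟩
  exact ⟨fun v w => (hall v).symm.trans (hall w)⟩

theorem isQuadrangulation_schaefferMap (hθ : θ.Recurrent)
    (hfin : (∀ c, θ.succ c ≠ none) ∨ Finite θ.Corner)
    (htr : ∀ c, θ.contour.SameCycle (θ.rootCorner h) c) :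
    (θ.schaefferMap h η).IsQuadrangulation where
  connected := connected_schaefferMap h η hθ htr
  locallyFinite := mem_periodicPts_arcRot hθ hfin
  face_degree := minimalPeriod_arcFaceNext hθ

end SchaefferMap

/-! ### The contour visits all corners -/

/-- The contour leads from `c` to `d`. -/
def Reach (θ : LabeledTree) (c d : List ℕ × ℕ) : Prop := ∃ n : ℕ, θ.nextFun^[n] c = d

theorem Reach.refl (c : List ℕ × ℕ) : θ.Reach c c := ⟨0, rfl⟩

theorem Reach.trans {c d e : List ℕ × ℕ} (h : θ.Reach c d) (h' : θ.Reach d e) : θ.Reach c e := by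
  obtain ⟨n, rfl⟩ := h
  obtain ⟨k, rfl⟩ := h'
  exact ⟨k + n, Function.iterate_add_apply _ _ _ _⟩

theorem Reach.of_next {c d : List ℕ × ℕ} (h : θ.nextFun c = d) : θ.Reach c d := ⟨1, h⟩

theorem nextFun_of_lt {u : List ℕ} {i : ℕ} (h : i < θ.numChildren u) :
    θ.nextFun (u, i) = (i :: u, 0) := by
  simp [nextFun, h]

theorem nextFun_last {v : List ℕ} {j : ℕ} (h : ¬ (v = [] ∧ j + 1 = θ.numChildren [])) :
    θ.nextFun (j :: v, θ.numChildren (j :: v)) = (v, j + 1) := by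
  simp [nextFun, h]

theorem nextFun_last_root {j : ℕ} (h : j + 1 = θ.numChildren []) :
    θ.nextFun ([j], θ.numChildren [j]) = ([], 0) := by
  simp [nextFun, h]

theorem coe_contour_pow (n : ℕ) (c : θ.Corner) :
    ((θ.contour ^ n) c).1 = θ.nextFun^[n] c.1 := by
  induction n with
  | zero => rfl
  | succ n ih => rw [contour_pow_succ, Function.iterate_succ_apply', ← ih]; rfl

theorem reach_iff {c d : θ.Corner} : θ.Reach c.1 d.1 ↔ ∃ n, (θ.contour ^ n) c = d := by
  refine exists_congr fun n => ?_
  rw [← coe_contour_pow]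
  exact Subtype.ext_iff.symm

theorem Reach.sameCycle {c d : θ.Corner} (h : θ.Reach c.1 d.1) : θ.contour.SameCycle c d := by
  obtain ⟨n, h⟩ := reach_iff.1 h
  exact ⟨n, by rwa [zpow_natCast]⟩

/-- The contour goes from one corner of `v` to the next by making the tour of the subtree between
them. -/
theorem reach_of_children {v : List ℕ} {a b : ℕ} (hab : a ≤ b) (hb : b ≤ θ.numChildren v)
    (hroot : v = [] → b < θ.numChildren [])
    (h : ∀ i, a ≤ i → i < b → θ.Reach (i :: v, 0) (i :: v, θ.numChildren (i :: v))) :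
    θ.Reach (v, a) (v, b) := by
  induction b, hab using Nat.le_induction with
  | base => exact Reach.refl _
  | succ b hab ih =>
    have h1 := ih (by omega) (fun hv => by have := hroot hv; omega)
      fun i hi hib => h i hi (by omega)
    refine (h1.trans (Reach.of_next (nextFun_of_lt (by omega)))).trans
      ((h b hab (by omega)).trans (Reach.of_next (nextFun_last ?_)))
    rintro ⟨hv, hb'⟩
    have := hroot hv
    omega

/-- `w` is a child of `v`. -/
def IsChild (θ : LabeledTree) (w v : List ℕ) : Prop := w ∈ θ.verts ∧ ∃ j, w = j :: v

/-- Accessibility means that no infinite path descends from `v`; the tour of its subtree then ends,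
by well-founded induction. -/
theorem reach_last_of_acc {v : List ℕ} (hv : Acc θ.IsChild v) (hne : v ≠ []) :
    θ.Reach (v, 0) (v, θ.numChildren v) := by
  induction hv with
  | intro v _ ih =>
    refine reach_of_children (Nat.zero_le _) le_rfl (fun h => absurd h hne) fun i _ hi => ?_
    exact ih (i :: v) ⟨(θ.child_mem_iff v i).2 hi, i, rfl⟩ (List.cons_ne_nil _ _)

theorem Acc.reach {v : List ℕ} (hv : Acc θ.IsChild v) {a b : ℕ} (hab : a ≤ b)
    (hb : θ.IsCorner (v, b)) : θ.Reach (v, a) (v, b) :=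
  reach_of_children hab hb.2.1 hb.2.2 fun i _ hi =>
    reach_last_of_acc (hv.inv ⟨(θ.child_mem_iff v i).2 (hi.trans_le hb.2.1), i, rfl⟩)
      (List.cons_ne_nil _ _)

theorem sameCycle_of_acc {v : List ℕ} {j i : ℕ} (hv : Acc θ.IsChild (j :: v))
    (hi : θ.IsCorner (j :: v, i)) :
    θ.contour.SameCycle (θ.corner v j (isCorner_parent hi.1)) (θ.corner (j :: v) i hi) :=
  Reach.sameCycle ((Reach.of_next (nextFun_of_lt ((θ.child_mem_iff v j).1 hi.1))).trans
    (Acc.reach hv (Nat.zero_le _) hi))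

theorem exists_chain_of_not_acc {v : List ℕ} (h : ¬ Acc θ.IsChild v) :
    ∃ f : ℕ → List ℕ, f 0 = v ∧ (∀ n, f (n + 1) ∈ θ.verts) ∧ (∀ n, ∃ j, f (n + 1) = j :: f n) ∧
      ∀ n, (f n).length = v.length + n := by
  obtain ⟨f, h0, hf⟩ := not_acc_iff_exists_descending_chain.1 h
  refine ⟨f, h0, fun n => (hf n).1, fun n => (hf n).2, fun n => ?_⟩
  induction n with
  | zero => rw [h0]; rfl
  | succ n ih =>
    obtain ⟨j, hj⟩ := (hf n).2
    rw [hj, List.length_cons, ih]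
    omega

/-! ### Finite trees -/

theorem acc_of_finite (hfin : θ.verts.Finite) (v : List ℕ) : Acc θ.IsChild v := by
  by_contra h
  obtain ⟨f, -, hf, -, hlen⟩ := exists_chain_of_not_acc h
  refine Set.infinite_of_injective_forall_mem (f := fun n => f (n + 1)) ?_ hf hfin
  intro a b hab
  have := congrArg List.length hab
  dsimp only at this
  rw [hlen, hlen] at this
  omega

theorem sameCycle_of_finite (hfin : θ.verts.Finite) (h : 0 < θ.numChildren []) (c : θ.Corner) :
    θ.contour.SameCycle (θ.rootCorner h) c := by
  obtain ⟨u, i, hc, rfl⟩ := exists_eq_corner c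
  induction u generalizing i with
  | nil => exact Reach.sameCycle (Acc.reach (acc_of_finite hfin _) (Nat.zero_le _) hc)
  | cons j v ih => exact (ih j _).trans (sameCycle_of_acc (acc_of_finite hfin _) hc)

theorem finite_corner (hfin : θ.verts.Finite) : Finite θ.Corner := by
  have := hfin.to_subtype
  refine Set.finite_univ_iff.1 ((Set.finite_iUnion finite_setOf_vert_eq).subset fun c _ => ?_)
  exact Set.mem_iUnion.2 ⟨c.vert, rfl⟩

theorem recurrent_of_finite (hfin : θ.verts.Finite) : θ.Recurrent := by
  have := finite_corner hfin
  intro c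
  have ho := isOfFinOrder_of_finite θ.contour
  refine ⟨⟨orderOf θ.contour, ho.orderOf_pos, ?_⟩, orderOf θ.contour, ho.orderOf_pos, ?_⟩
  · rw [pow_orderOf_eq_one]
    rfl
  · rw [back_eq, pow_orderOf_eq_one]
    rfl

/-! ### Trees with one spine -/

/-- A spine that is the only one, on which the labels have infimum `-∞`. -/
structure IsGoodSpine (θ : LabeledTree) (S : ℕ → θ.verts) : Prop where
  isSpine : θ.IsSpine S
  unique : ∀ S', θ.IsSpine S' → S' = S
  not_bddBelow : ¬ BddBelow (Set.range fun i => θ.label (S i))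

theorem exists_isGoodSpine (hθ : θ ∈ oneSpineTrees) : ∃ S, θ.IsGoodSpine S := by
  obtain ⟨-, -, S, h1, h2, h3⟩ := hθ
  exact ⟨S, h1, h2, h3⟩

theorem drop_mem {u : List ℕ} (hu : u ∈ θ.verts) (n : ℕ) : u.drop n ∈ θ.verts := by
  induction u generalizing n with
  | nil => simpa using hu
  | cons j v ih =>
    cases n with
    | zero => exact hu
    | succ n => exact ih (θ.parent_mem v j hu) n

namespace IsGoodSpine

variable {S : ℕ → θ.verts}

theorem zero (hS : θ.IsGoodSpine S) : (S 0).1 = [] := by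
  rw [hS.isSpine.1]
  rfl

theorem length (hS : θ.IsGoodSpine S) (n : ℕ) : (S n).1.length = n := by
  induction n with
  | zero => rw [hS.zero]; rfl
  | succ n ih =>
    obtain ⟨j, hj⟩ := hS.isSpine.2 n
    rw [hj, List.length_cons, ih]

/-- An infinite path down from `v`, preceded by the ancestors of `v`, would be a spine through `v`.
-/
theorem acc (hS : θ.IsGoodSpine S) {v : List ℕ} (hv : v ∈ θ.verts) (hne : ∀ n, (S n).1 ≠ v) :
    Acc θ.IsChild v := by
  by_contra h
  obtain ⟨f, h0, hf, hstep, hlen⟩ := exists_chain_of_not_acc h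
  have hmem : ∀ n, f n ∈ θ.verts := fun n => by
    cases n with
    | zero => rwa [h0]
    | succ n => exact hf n
  have hpre : ∀ n, (f n).drop n = v := fun n => by
    induction n with
    | zero => exact h0
    | succ n ih =>
      obtain ⟨j, hj⟩ := hstep n
      rw [hj, List.drop_succ_cons, ih]
  -- The word `f n` has length `v.length + n`, so this is its ancestor at height `n`.
  have hspine : θ.IsSpine fun n => ⟨(f n).drop v.length, drop_mem (hmem n) _⟩ := by
    constructor
    · apply Subtype.ext
      change (f 0).drop v.length = []
      rw [h0, List.drop_length]
    · intro n
      dsimp only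
      have hlt : v.length < (f (n + 1)).length := by
        rw [hlen]
        omega
      obtain ⟨j, hj⟩ := hstep n
      refine ⟨(f (n + 1))[v.length], ?_⟩
      rw [List.drop_eq_getElem_cons hlt]
      congr 1
      rw [hj, List.drop_succ_cons]
  have := congrFun (hS.unique _ hspine) v.length
  refine hne v.length ?_
  rw [← this]
  exact hpre _

/-- The place among its siblings of the next vertex on the spine. -/
def next (hS : θ.IsGoodSpine S) (n : ℕ) : ℕ := (hS.isSpine.2 n).choose

theorem succ_eq (hS : θ.IsGoodSpine S) (n : ℕ) : (S (n + 1)).1 = hS.next n :: (S n).1 :=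
  (hS.isSpine.2 n).choose_spec

theorem next_lt (hS : θ.IsGoodSpine S) (n : ℕ) : hS.next n < θ.numChildren (S n).1 := by
  rw [← θ.child_mem_iff, ← hS.succ_eq]
  exact (S (n + 1)).2

theorem acc_child (hS : θ.IsGoodSpine S) {n i : ℕ} (hi : i < θ.numChildren (S n).1)
    (hne : i ≠ hS.next n) : Acc θ.IsChild (i :: (S n).1) := by
  refine hS.acc ((θ.child_mem_iff _ _).2 hi) fun k hk => hne ?_
  have h1 := congrArg List.length hk
  rw [List.length_cons, hS.length, hS.length] at h1
  rw [h1, hS.succ_eq] at hk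
  exact (List.head_eq_of_cons_eq hk).symm

theorem reach_of_lt_or_gt (hS : θ.IsGoodSpine S) {n a b : ℕ} (hab : a ≤ b)
    (hb : b ≤ θ.numChildren (S n).1) (hroot : (S n).1 = [] → b < θ.numChildren [])
    (h : b ≤ hS.next n ∨ hS.next n < a) : θ.Reach ((S n).1, a) ((S n).1, b) :=
  reach_of_children hab hb hroot fun i hai hib =>
    reach_last_of_acc (hS.acc_child (by omega) (by omega)) (List.cons_ne_nil _ _)

theorem eq_zero_of_eq_nil (hS : θ.IsGoodSpine S) {n : ℕ} (hn : (S n).1 = []) : n = 0 := by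
  rw [← hS.length n, hn]
  rfl

theorem reach_left (hS : θ.IsGoodSpine S) (n : ℕ) {i : ℕ} (hi : i ≤ hS.next n) :
    θ.Reach ([], 0) ((S n).1, i) := by
  have hlt := hS.next_lt n
  have hroot : (S n).1 = [] → i < θ.numChildren [] := fun h => by
    rw [h] at hlt
    omega
  have h1 := hS.reach_of_lt_or_gt (Nat.zero_le i) (by omega) hroot (Or.inl hi)
  refine Reach.trans ?_ h1
  clear h1 hi hroot hlt
  induction n with
  | zero => rw [hS.zero]; exact Reach.refl _
  | succ n ih =>
    have hlt := hS.next_lt n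
    have hroot : (S n).1 = [] → hS.next n < θ.numChildren [] := fun h => by
      rwa [h] at hlt
    have h1 := hS.reach_of_lt_or_gt (Nat.zero_le (hS.next n)) hlt.le hroot (Or.inl le_rfl)
    rw [hS.succ_eq]
    exact (ih.trans h1).trans (Reach.of_next (nextFun_of_lt hlt))

theorem reach_right_root (hS : θ.IsGoodSpine S) {i : ℕ} (hi : hS.next 0 < i)
    (hik : i < θ.numChildren []) : θ.Reach ([], i) ([], 0) := by
  have hz := hS.zero
  have h1 := hS.reach_of_lt_or_gt (n := 0) (a := i) (b := θ.numChildren [] - 1) (by omega)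
    (by rw [hz]; omega) (fun _ => by omega) (Or.inr hi)
  rw [hz] at h1
  have h2 := hS.acc_child (n := 0) (i := θ.numChildren [] - 1) (by rw [hz]; omega) (by omega)
  rw [hz] at h2
  refine (h1.trans (Reach.of_next (nextFun_of_lt (by omega)))).trans ?_
  exact (reach_last_of_acc h2 (List.cons_ne_nil _ _)).trans
    (Reach.of_next (nextFun_last_root (by omega)))

theorem reach_right_last (hS : θ.IsGoodSpine S) (n : ℕ) :
    θ.Reach ((S (n + 1)).1, θ.numChildren (S (n + 1)).1) ([], 0) := by
  induction n with
  | zero =>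
    have hlt := hS.next_lt 0
    rw [hS.succ_eq]
    rw [hS.zero] at hlt ⊢
    rcases (Nat.succ_le_of_lt hlt).lt_or_eq with h | h
    · refine (Reach.of_next (nextFun_last ?_)).trans (hS.reach_right_root (Nat.lt_succ_self _) h)
      rintro ⟨-, h'⟩
      omega
    · exact Reach.of_next (nextFun_last_root h)
  | succ n ih =>
    have hlt := hS.next_lt (n + 1)
    have hne : (S (n + 1)).1 ≠ [] := fun h => by
      have := hS.eq_zero_of_eq_nil h
      omega
    rw [hS.succ_eq (n + 1)]
    refine (Reach.of_next (nextFun_last fun h => hne h.1)).trans (Reach.trans ?_ ih)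
    exact hS.reach_of_lt_or_gt (Nat.succ_le_of_lt hlt) le_rfl (fun h => absurd h hne)
      (Or.inr (Nat.lt_succ_self _))

/-- From the root corner the contour leads to the corners on the left of the spine, and from those
on its right it leads to the root corner. The corners off the spine are reached from the parent. -/
theorem sameCycle (hS : θ.IsGoodSpine S) (h : 0 < θ.numChildren []) (c : θ.Corner) :
    θ.contour.SameCycle (θ.rootCorner h) c := by
  obtain ⟨u, i, hc, rfl⟩ := exists_eq_corner c
  induction u generalizing i with
  | nil =>
    rcases le_or_gt i (hS.next 0) with hi | hi
    · have := hS.reach_left 0 hi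
      rw [hS.zero] at this
      exact this.sameCycle
    · exact (Reach.sameCycle (c := θ.corner _ _ hc) (d := θ.rootCorner h)
        (hS.reach_right_root hi (hc.2.2 rfl))).symm
  | cons j v ih =>
    by_cases hu : ∃ n, (S n).1 = j :: v
    · obtain ⟨n, hn⟩ := hu
      have hcn : i ≤ θ.numChildren (S n).1 := by
        rw [hn]
        exact hc.2.1
      rcases le_or_gt i (hS.next n) with hi | hi
      · have := hS.reach_left n hi
        rw [hn] at this
        exact this.sameCycle
      · cases n with
        | zero => rw [hS.zero] at hn; cases hn
        | succ n =>
          have := (hS.reach_of_lt_or_gt (b := θ.numChildren (S (n + 1)).1) hcn le_rfl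
            (fun h' => by rw [hn] at h'; cases h') (Or.inr hi)).trans (hS.reach_right_last n)
          rw [hn] at this
          exact (Reach.sameCycle (c := θ.corner _ _ hc) (d := θ.rootCorner h) this).symm
    · push Not at hu
      exact (ih j _).trans (sameCycle_of_acc (hS.acc hc.1 hu) hc)

/-- Far away on both sides of the spine there are corners, of the same vertex, with small labels. -/
theorem exists_far (hS : θ.IsGoodSpine S) (h : 0 < θ.numChildren []) (M : ℕ) (a : ℤ) :
    ∃ c c' : θ.Corner, c.vert = c'.vert ∧ θ.cornerLabel c < a ∧
      (∃ N > M, (θ.contour ^ N) (θ.rootCorner h) = c) ∧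
      ∃ N > M, θ.back N (θ.rootCorner h) = c' := by
  have hfin : (((fun N => θ.cornerLabel ((θ.contour ^ N) (θ.rootCorner h))) '' Set.Iic M) ∪
      ((fun N => θ.cornerLabel (θ.back N (θ.rootCorner h))) '' Set.Iic M) ∪ {a}).Finite :=
    (((Set.finite_Iic M).image _).union ((Set.finite_Iic M).image _)).union (Set.finite_singleton a)
  obtain ⟨b, hb⟩ := hfin.bddBelow
  -- As `b` bounds all labels within `M` steps of the root corner, no corner of this spine vertex
  -- can be that close on either side.
  obtain ⟨n, hn⟩ : ∃ n, θ.label (S n) < b := by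
    by_contra! hcon
    exact hS.not_bddBelow ⟨b, by rintro _ ⟨n, rfl⟩; exact hcon n⟩
  have hc : θ.IsCorner ((S n).1, 0) := ⟨(S n).2, Nat.zero_le _, fun _ => h⟩
  obtain ⟨N, hN⟩ := (reach_iff (c := θ.rootCorner h) (d := θ.corner _ _ hc)).1
    (hS.reach_left n (Nat.zero_le _))
  have hNM : M < N := by
    by_contra! hle
    have := hb (Or.inl (Or.inl ⟨N, hle, rfl⟩))
    dsimp only at this
    rw [hN] at this
    exact absurd hn (not_lt.2 this)
  cases n with
  | zero =>
    have := hb (Or.inl (Or.inl ⟨0, Nat.zero_le _, rfl⟩))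
    rw [hS.isSpine.1] at hn
    exact absurd hn (not_lt.2 this)
  | succ n =>
    have hne : (S (n + 1)).1 ≠ [] := fun h => by
      have := hS.eq_zero_of_eq_nil h
      omega
    have hc' : θ.IsCorner ((S (n + 1)).1, θ.numChildren (S (n + 1)).1) :=
      ⟨(S (n + 1)).2, le_rfl, fun h => absurd h hne⟩
    obtain ⟨N', hN'⟩ := (reach_iff (c := θ.corner _ _ hc') (d := θ.rootCorner h)).1
      (hS.reach_right_last n)
    have hN'' : θ.back N' (θ.rootCorner h) = θ.corner _ _ hc' := by
      rw [← hN', back_contour_pow]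
    refine ⟨θ.corner _ _ hc, θ.corner _ _ hc', rfl, lt_of_lt_of_le hn (hb (Or.inr rfl)), ⟨N, hNM, hN⟩, N', ?_, hN''⟩
    by_contra! hle
    have := hb (Or.inl (Or.inr ⟨N', hle, rfl⟩))
    dsimp only at this
    rw [hN''] at this
    exact absurd hn (not_lt.2 this)

theorem exists_contour_pow_lt (hS : θ.IsGoodSpine S) (h : 0 < θ.numChildren []) (c : θ.Corner)
    (a : ℤ) (M : ℕ) : ∃ n > M, θ.cornerLabel ((θ.contour ^ n) c) < a := by
  obtain ⟨i, rfl⟩ := hS.sameCycle h c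
  -- The extra `i.natAbs` makes up for starting at position `i` and not at the root corner.
  obtain ⟨d, -, -, hd, ⟨N, hN, rfl⟩, -⟩ := hS.exists_far h (M + i.natAbs) a
  refine ⟨(N - i).toNat, by omega, ?_⟩
  rwa [← zpow_natCast, Int.toNat_of_nonneg (by omega), ← Equiv.Perm.mul_apply, ← zpow_add,
    sub_add_cancel, zpow_natCast]

theorem exists_back_lt (hS : θ.IsGoodSpine S) (h : 0 < θ.numChildren []) (c : θ.Corner)
    (a : ℤ) (M : ℕ) : ∃ n > M, θ.cornerLabel (θ.back n c) < a := by
  obtain ⟨i, rfl⟩ := hS.sameCycle h c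
  obtain ⟨d, d', hdd, hd, -, N, hN, rfl⟩ := hS.exists_far h (M + i.natAbs) a
  refine ⟨(N + i).toNat, by omega, ?_⟩
  rw [cornerLabel_eq, hdd, ← cornerLabel_eq, back_eq, ← zpow_natCast, ← zpow_neg] at hd
  rwa [back_eq, ← zpow_natCast, ← zpow_neg, Int.toNat_of_nonneg (by omega),
    ← Equiv.Perm.mul_apply, ← zpow_add, show -((N : ℤ) + i) + i = -N by ring]

theorem recurrent (hS : θ.IsGoodSpine S) (h : 0 < θ.numChildren []) : θ.Recurrent := by
  intro c
  obtain ⟨n, hn, hlt⟩ := hS.exists_contour_pow_lt h c (θ.cornerLabel c) 0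
  obtain ⟨k, hk, hlt'⟩ := hS.exists_back_lt h c (θ.cornerLabel c) 0
  exact ⟨⟨n, hn, hlt.le⟩, k, hk, hlt'.le⟩

theorem succ_ne_none (hS : θ.IsGoodSpine S) (h : 0 < θ.numChildren []) (c : θ.Corner) :
    θ.succ c ≠ none := by
  rw [ne_eq, succ_eq_none_iff]
  intro h'
  obtain ⟨n, -, hlt⟩ := hS.exists_contour_pow_lt h c (θ.cornerLabel c) 0
  exact absurd (h' n) (not_le.2 hlt)

end IsGoodSpine

theorem isQuadrangulation_of_mem (hθ : θ ∈ oneSpineTrees ∪ finiteTrees)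
    (h : 0 < θ.numChildren []) (η : Bool) : (θ.schaefferMap h η).IsQuadrangulation := by
  rcases hθ with hθ | hθ
  · obtain ⟨S, hS⟩ := exists_isGoodSpine hθ
    exact isQuadrangulation_schaefferMap h η (hS.recurrent h) (Or.inl (hS.succ_ne_none h))
      (hS.sameCycle h)
  · exact isQuadrangulation_schaefferMap h η (recurrent_of_finite hθ.1)
      (Or.inr (finite_corner hθ.1)) (sameCycle_of_finite hθ.1 h)

/-! ### Euler's formula -/

/-- The corner of a vertex (other than the root) that precedes the edge to the parent. -/
def lastCorner (θ : LabeledTree) (v : {v : θ.verts // v ≠ θ.rootVert}) : θ.Corner :=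
  θ.corner v.1.1 (θ.numChildren v.1.1) ⟨v.1.2, le_rfl, fun h => absurd (Subtype.ext h) v.2⟩

theorem lastCorner_ne_opp (v w : {v : θ.verts // v ≠ θ.rootVert}) :
    θ.lastCorner v ≠ θ.opp (θ.lastCorner w) := by
  obtain ⟨⟨w, hw⟩, hw0⟩ := w
  match w, hw, hw0 with
  | [], hw, hw0 => exact absurd rfl hw0
  | j :: u, hw, hw0 =>
    intro h
    have h' : θ.opp (θ.lastCorner ⟨⟨j :: u, hw⟩, hw0⟩) = θ.corner u j (isCorner_parent hw) :=
      opp_of_eq _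
    rw [h'] at h
    have h := congrArg Subtype.val h
    have h1 : v.1.1 = u := congrArg Prod.fst h
    have h2 : θ.numChildren v.1.1 = j := congrArg Prod.snd h
    have := (θ.child_mem_iff u j).1 hw
    rw [h1] at h2
    omega

/-- The edge from `v` to its parent has two sides, the last corner of `v` and its opposite. -/
theorem card_corner : Nat.card θ.Corner = 2 * Nat.card {v : θ.verts // v ≠ θ.rootVert} := by
  let g : {v : θ.verts // v ≠ θ.rootVert} × Bool → θ.Corner := fun p =>
    if p.2 then θ.lastCorner p.1 else θ.opp (θ.lastCorner p.1)
  have hlast : Function.Injective θ.lastCorner := fun v w h =>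
    Subtype.ext (Subtype.ext (congrArg (fun c : θ.Corner => c.1.1) h))
  have hopp : Function.Injective θ.opp := Function.LeftInverse.injective opp_opp
  have hg : Function.Bijective g := by
    constructor
    · rintro ⟨v, b⟩ ⟨w, b'⟩ h
      cases b <;> cases b' <;> simp only [g, Bool.false_eq_true, if_true, if_false] at h
      · rw [hlast (hopp h)]
      · exact absurd h.symm (lastCorner_ne_opp w v)
      · exact absurd h (lastCorner_ne_opp v w)
      · rw [hlast h]
    · intro c
      rcases corner_cases c with ⟨u, i, h, hi, rfl⟩ | ⟨v, j, h, rfl⟩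
      · refine ⟨(⟨⟨i :: u, (θ.child_mem_iff u i).2 hi⟩, fun h => ?_⟩, false), ?_⟩
        · exact absurd (congrArg Subtype.val h) (List.cons_ne_nil _ _)
        · rw [← opp_opp (θ.corner u i h), opp_of_lt h hi]
          rfl
      · refine ⟨(⟨⟨j :: v, h.1⟩, fun h => ?_⟩, true), rfl⟩
        exact absurd (congrArg Subtype.val h) (List.cons_ne_nil _ _)
  rw [← Nat.card_congr (Equiv.ofBijective g hg), Nat.card_prod]
  simp [mul_comm]

theorem card_verts (hfin : θ.verts.Finite) :
    Nat.card θ.verts = Nat.card {v : θ.verts // v ≠ θ.rootVert} + 1 := by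
  classical
  have := hfin.to_subtype
  rw [← Nat.card_congr (Equiv.optionSubtypeNe θ.rootVert), Finite.card_option]

section SchaefferMap

variable (h : 0 < θ.numChildren []) (η : Bool)

theorem card_edge_schaefferMap : Nat.card (θ.schaefferMap h η).Edge = Nat.card θ.Corner :=
  Nat.card_congr
    { toFun := Quot.lift (fun d : θ.ArcDart => d.1) (by rintro d _ rfl; rfl)
      invFun := fun c => Quot.mk _ (c, true)
      left_inv := by
        rintro ⟨⟨c, b⟩⟩
        cases b
        · exact Quot.sound rfl
        · rfl
      right_inv := fun c => rfl }

theorem card_face_schaefferMap (hfin : θ.verts.Finite) :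
    2 * Nat.card θ.Corner = 4 * Nat.card (θ.schaefferMap h η).Face := by
  have := finite_corner hfin
  have h4 : Nat.card θ.ArcDart = 4 * Nat.card (θ.schaefferMap h η).Face :=
    card_eq_mul_card_quot (by norm_num) (minimalPeriod_arcFaceNext (recurrent_of_finite hfin))
  rw [← h4, Nat.card_prod]
  simp [mul_comm]

theorem origin_eq_of_arcVert_eq_some (hθ : θ.Recurrent) {d d' : θ.ArcDart} {u : θ.verts}
    (hd : θ.arcVert d = some u) (hd' : θ.arcVert d' = some u) :
    (θ.schaefferMap h η).origin d = (θ.schaefferMap h η).origin d' := by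
  have key : ∀ d, θ.arcVert d = some u → ∃ c : θ.Corner, c.vert = u ∧
      (θ.schaefferMap h η).origin d = (θ.schaefferMap h η).origin (c, true) := by
    rintro ⟨c, b⟩ hd
    cases b
    · change (θ.succ c).map Corner.vert = some u at hd
      rw [Option.map_eq_some_iff] at hd
      obtain ⟨s, hs, hu⟩ := hd
      exact ⟨s, hu, origin_of_succ_eq h η hθ hs⟩
    · exact ⟨c, Option.some_injective _ hd, rfl⟩
  obtain ⟨c, hc, h1⟩ := key d hd
  obtain ⟨c', hc', h2⟩ := key d' hd'
  rw [h1, h2]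
  exact origin_eq_of_vert_eq h η hθ (hc.trans hc'.symm)

/-- The rotation around `ρ` visits the corners without successor one by one, backwards along the
contour. -/
theorem origin_back_of_succ_eq_none {c : θ.Corner} {n : ℕ} (hc : θ.succ c = none)
    (hn : θ.succ (θ.back n c) = none) :
    (θ.schaefferMap h η).origin (θ.back n c, false) =
      (θ.schaefferMap h η).origin (c, false) := by
  induction n using Nat.strong_induction_on generalizing c with
  | _ n ih =>
    rcases Nat.eq_zero_or_pos n with rfl | h0
    · rfl
    · rcases arcRot_false_cases c with ⟨p, hp, hr, hsp, hi⟩ | ⟨s, hs, -⟩ | ⟨-, h'⟩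
      · have hpn : p ≤ n := by
          by_contra! hlt
          exact (hi n h0 hlt).2 (by rw [hn, hc])
        rw [← origin_arcRot h η (c, false), hr]
        have heq : θ.back n c = θ.back (n - p) (θ.back p c) := by
          rw [← back_add, Nat.sub_add_cancel hpn]
        rw [heq] at hn ⊢
        exact ih (n - p) (by omega) (hsp.trans hc) hn
      · rw [hc] at hs
        cases hs
      · exact absurd hn (h' n h0)

theorem card_vertex_schaefferMap (hfin : θ.verts.Finite) :
    Nat.card (θ.schaefferMap h η).Vertex = Nat.card θ.verts + 1 := by
  have := finite_corner hfin
  have := hfin.to_subtype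
  have hθ := recurrent_of_finite hfin
  rw [← Finite.card_option]
  refine Nat.card_congr (Equiv.ofBijective (Quot.lift θ.arcVert ?_) ⟨?_, ?_⟩)
  · rintro d _ rfl
    exact (arcVert_arcRot d).symm
  · rintro ⟨d⟩ ⟨d'⟩ hdd
    change θ.arcVert d = θ.arcVert d' at hdd
    change (θ.schaefferMap h η).origin d = (θ.schaefferMap h η).origin d'
    rcases hd : θ.arcVert d with _ | u
    · have hd' := hdd.symm.trans hd
      obtain ⟨c, b⟩ := d
      obtain ⟨c', b'⟩ := d'
      cases b
      · cases b'
        · have hc := Option.map_eq_none_iff.1 hd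
          have hc' := Option.map_eq_none_iff.1 hd'
          have hsc : θ.contour⁻¹.SameCycle c c' :=
            ((sameCycle_of_finite hfin h c).symm.trans (sameCycle_of_finite hfin h c')).inv
          obtain ⟨n, hn⟩ := hsc.exists_nat_pow_eq
          have hn : θ.back n c = c' := hn
          subst hn
          exact (origin_back_of_succ_eq_none h η hc hc').symm
        · cases hd'
      · cases hd
    · exact origin_eq_of_arcVert_eq_some h η hθ hd (hdd.symm.trans hd)
  · rintro (_ | ⟨u, hu⟩)
    · have : Nonempty θ.Corner := ⟨θ.rootCorner h⟩
      -- A corner of minimal label has no successor, so `ρ` is the end of some arc.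
      obtain ⟨c, hc⟩ := Finite.exists_min θ.cornerLabel
      refine ⟨Quot.mk _ (c, false), ?_⟩
      change (θ.succ c).map Corner.vert = none
      rw [Option.map_eq_none_iff, succ_eq_none_iff]
      exact fun n => hc _
    · exact ⟨Quot.mk _ (θ.corner u 0 ⟨hu, Nat.zero_le _, fun _ => h⟩, true), rfl⟩

theorem isFinitePlanarQuadrangulation_schaefferMap (hθ : θ ∈ finiteTrees) :
    (θ.schaefferMap h η).IsFinitePlanarQuadrangulation where
  toIsQuadrangulation := isQuadrangulation_of_mem (Or.inr hθ) h η
  finite := by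
    have := finite_corner hθ.1
    exact inferInstanceAs (Finite (θ.Corner × Bool))
  euler := by
    have h1 := card_vertex_schaefferMap h η hθ.1
    have h2 := card_face_schaefferMap h η hθ.1
    have h3 := card_edge_schaefferMap h η
    have h4 := card_corner (θ := θ)
    have h5 := card_verts hθ.1
    omega

end SchaefferMap

end LabeledTree

/-! ### Finite balls and infinite components -/

theorem RootedMap.finite_setOf_inBall {m : RootedMap} (hm : m.IsQuadrangulation) (r : ℕ) :
    {d | m.InBall r d}.Finite :=
  (RootedMap.finite_rootDist_le hm.locallyFinite (r + 5)).subset fun _ hd =>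
    RootedMap.InBall.rootDist_le hm.face_degree hd

theorem RootedMap.finite_ballVertices {m : RootedMap} (hm : m.IsQuadrangulation) (r : ℕ) :
    (m.ballVertices r).Finite :=
  ((RootedMap.finite_setOf_inBall hm r).image m.origin).subset fun _ ⟨d, hd, h⟩ => ⟨d, hd, h⟩

/-- If all but finitely many vertices of an infinite graph are in one component, then this is the
only infinite component. -/
theorem SimpleGraph.existsUnique_infinite_component {V : Type*} [Infinite V] {G : SimpleGraph V}
    (v : V) (hv : {w | ¬ G.Reachable v w}.Finite) :
    ∃! C : G.ConnectedComponent, C.supp.Infinite := by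
  have hc : (G.connectedComponentMk v).suppᶜ.Finite := by
    refine hv.subset fun w hw h => hw ?_
    exact (SimpleGraph.ConnectedComponent.mem_supp_iff _ _).2
      (SimpleGraph.ConnectedComponent.eq.2 h.symm)
  refine ⟨G.connectedComponentMk v, Set.infinite_of_finite_compl hc, fun C hC => ?_⟩
  obtain ⟨w, hw, hw'⟩ := hC.exists_notMem_finite hc
  rw [Set.notMem_compl_iff] at hw'
  rw [← (SimpleGraph.ConnectedComponent.mem_supp_iff _ _).1 hw,
    ← (SimpleGraph.ConnectedComponent.mem_supp_iff _ _).1 hw']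

namespace LabeledTree

variable {θ : LabeledTree}

/-! ### One-endedness -/

theorem zpow_add_natCast (i : ℤ) (n : ℕ) (c : θ.Corner) :
    (θ.contour ^ (i + n)) c = (θ.contour ^ n) ((θ.contour ^ i) c) := by
  rw [add_comm, zpow_add, zpow_natCast, Equiv.Perm.mul_apply]

namespace IsGoodSpine

variable {S : ℕ → θ.verts} (h : 0 < θ.numChildren []) (η : Bool)

/-- A repetition would make the contour periodic, and its labels would be bounded below. -/
theorem zpow_injective (hS : θ.IsGoodSpine S) (c : θ.Corner) :
    Function.Injective fun i : ℤ => (θ.contour ^ i) c := by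
  have key : ∀ i j : ℤ, i < j → (θ.contour ^ i) c ≠ (θ.contour ^ j) c := by
    intro i j hij heq
    obtain ⟨p, hp⟩ := Int.eq_ofNat_of_zero_le (sub_nonneg.2 hij.le)
    have hp0 : 0 < p := by omega
    obtain rfl : j = i + p := by omega
    rw [zpow_add_natCast] at heq
    generalize (θ.contour ^ i) c = d at heq
    have hper : Function.IsPeriodicPt θ.contour p d := by
      rw [Function.IsPeriodicPt, Equiv.Perm.iterate_eq_pow]
      exact heq.symm
    obtain ⟨b, hb⟩ := ((Set.finite_Iio p).image
      fun n => θ.cornerLabel ((θ.contour ^ n) d)).bddBelow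
    obtain ⟨n, -, hn⟩ := hS.exists_contour_pow_lt
      (by
        have := hS.next_lt 0
        rw [hS.zero] at this
        omega) d b 0
    have h1 := hb ⟨n % p, Nat.mod_lt _ hp0, rfl⟩
    dsimp only at h1
    rw [← Equiv.Perm.iterate_eq_pow, hper.iterate_mod_apply, Equiv.Perm.iterate_eq_pow] at h1
    omega
  intro i j hij
  rcases lt_trichotomy i j with hlt | heq | hlt
  · exact absurd hij (key i j hlt)
  · exact heq
  · exact absurd hij.symm (key j i hlt)

theorem infinite_corner (hS : θ.IsGoodSpine S) (h : 0 < θ.numChildren []) : Infinite θ.Corner :=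
  Infinite.of_injective _ (hS.zpow_injective (θ.rootCorner h))

theorem isQuadrangulation (hS : θ.IsGoodSpine S) : (θ.schaefferMap h η).IsQuadrangulation :=
  isQuadrangulation_schaefferMap h η (hS.recurrent h) (Or.inl (hS.succ_ne_none h)) (hS.sameCycle h)

theorem exists_origin_eq (hS : θ.IsGoodSpine S) (v : (θ.schaefferMap h η).Vertex) :
    ∃ i : ℤ, (θ.schaefferMap h η).origin ((θ.contour ^ i) (θ.rootCorner h), true) = v := by
  have htrue : ∀ c : θ.Corner,
      ∃ i : ℤ, (θ.schaefferMap h η).origin ((θ.contour ^ i) (θ.rootCorner h), true) =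
        (θ.schaefferMap h η).origin (c, true) := fun c => by
    obtain ⟨i, rfl⟩ := hS.sameCycle h c
    exact ⟨i, rfl⟩
  obtain ⟨⟨c, b⟩⟩ := v
  cases b
  · obtain ⟨s, hs⟩ := Option.ne_none_iff_exists'.1 (hS.succ_ne_none h c)
    obtain ⟨i, hi⟩ := htrue s
    exact ⟨i, hi.trans (origin_of_succ_eq h η (hS.recurrent h) hs).symm⟩
  · exact htrue c

theorem infinite_vertex (hS : θ.IsGoodSpine S) : Infinite (θ.schaefferMap h η).Vertex := by
  by_contra hfin
  rw [not_infinite_iff_finite] at hfin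
  have hd : (Set.univ : Set θ.ArcDart).Finite :=
    (Set.finite_iUnion (RootedMap.finite_origin_eq
      (hS.isQuadrangulation h η).locallyFinite)).subset fun d _ => Set.mem_iUnion.2 ⟨_, rfl⟩
  have := hS.infinite_corner h
  have hinf : Infinite θ.ArcDart := inferInstanceAs (Infinite (θ.Corner × Bool))
  exact Set.infinite_univ hd

theorem oneEnded (hS : θ.IsGoodSpine S) : (θ.schaefferMap h η).OneEnded := by
  intro r
  have hm := hS.isQuadrangulation h η
  have hrec := hS.recurrent h
  set m := θ.schaefferMap h η with hm_def
  set A := m.ballVertices r with hA_def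
  have hA : A.Finite := RootedMap.finite_ballVertices hm r
  set pos : ℤ → θ.Corner := fun i => (θ.contour ^ i) (θ.rootCorner h) with hpos
  have hinj : Function.Injective pos := hS.zpow_injective _
  set P : ℤ → m.Vertex := fun i => m.origin (pos i, true) with hP
  have hsurj : ∀ v, ∃ i, P i = v := hS.exists_origin_eq h η
  obtain ⟨N, hN⟩ : ∃ N : ℕ, ∀ i : ℤ, N < i.natAbs → P i ∉ A := by
    have hfin : {i : ℤ | P i ∈ A}.Finite := by
      have hf := (hA.biUnion fun v _ => RootedMap.finite_origin_eq hm.locallyFinite v).preimage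
        (f := fun i : ℤ => (pos i, true))
        (fun i _ j _ hij => hinj (congrArg (fun d : θ.ArcDart => d.1) hij))
      exact hf.subset fun i hi => Set.mem_biUnion (x := P i) hi rfl
    obtain ⟨N, hN⟩ := (hfin.image Int.natAbs).bddAbove
    exact ⟨N, fun i hi hiA => absurd (hN ⟨i, hiA, rfl⟩) (not_le.2 hi)⟩
  obtain ⟨b, hb⟩ := ((Set.finite_Icc (-(N : ℤ)) N).image fun i => θ.cornerLabel (pos i)).bddBelow
  -- Position `-M` lies to the left of the window `[-N, N]` and its label is below all labels of the
  -- window, so an arc from farther left cannot end in the window.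
  obtain ⟨M, hMN, hM⟩ := hS.exists_back_lt h (θ.rootCorner h) b N
  rw [back_eq, ← zpow_natCast, ← zpow_neg] at hM
  have hpos_add : ∀ (i : ℤ) (n : ℕ), pos (i + n) = (θ.contour ^ n) (pos i) := fun i n =>
    zpow_add_natCast i n _
  have hsucc : ∀ i : ℤ, ((N : ℤ) < i ∨ i < -(M : ℤ)) → m.origin (pos i, false) ∉ A := by
    intro i hi
    obtain ⟨s, hs⟩ := Option.ne_none_iff_exists'.1 (hS.succ_ne_none h (pos i))
    rw [origin_of_succ_eq h η hrec hs]
    obtain ⟨n, hn, rfl, hl, hle⟩ := succ_eq_some_iff.1 hs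
    rw [← hpos_add]
    refine hN _ ?_
    by_contra! hcon
    have hin : -(N : ℤ) ≤ i + n ∧ i + n ≤ N := by omega
    have h1 := hb ⟨i + n, hin, rfl⟩
    dsimp only at h1
    rw [hpos_add] at h1
    have h2 := hle (-(M : ℤ) - i).toNat (by omega)
    rw [← hpos_add, Int.toNat_of_nonneg (by omega), add_sub_cancel] at h2
    have h3 : θ.cornerLabel (pos (-(M : ℤ))) < b := hM
    omega
  set K : Set m.Vertex := Aᶜ with hK
  let rel : m.Vertex → m.Vertex → Prop := fun v w =>
    ∃ (hv : v ∈ K) (hw : w ∈ K), (m.graph.induce K).Reachable ⟨v, hv⟩ ⟨w, hw⟩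
  have hsymm : ∀ v w, rel v w → rel w v := fun v w ⟨hv, hw, hr⟩ => ⟨hw, hv, hr.symm⟩
  have htrans : ∀ u v w, rel u v → rel v w → rel u w :=
    fun u v w ⟨hu, hv, hr⟩ ⟨_, hw, hr'⟩ => ⟨hu, hw, hr.trans hr'⟩
  have hadj : ∀ c : θ.Corner, m.origin (c, true) ∈ K → m.origin (c, false) ∈ K →
      rel (m.origin (c, true)) (m.origin (c, false)) := by
    intro c hc hc'
    refine ⟨hc, hc', ?_⟩
    rcases RootedMap.adj_or_eq (m := m) (c, true) with hadj | heq
    · exact SimpleGraph.Adj.reachable (G := m.graph.induce K) (u := ⟨_, hc⟩) (v := ⟨_, hc'⟩) hadj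
    · have : (⟨m.origin (c, true), hc⟩ : K) = ⟨m.origin (c, false), hc'⟩ := Subtype.ext heq
      rw [this]
  have hfar : ∀ i : ℤ, ((N : ℤ) < i ∨ i < -(M : ℤ)) → P i ∈ K := fun i hi => hN i (by omega)
  have hstep : ∀ i : ℤ, ((N : ℤ) < i ∨ i + 1 < -(M : ℤ)) → rel (P i) (P (i + 1)) := by
    intro i hi
    have h1 : pos (i + 1) = θ.contour (pos i) := hpos_add i 1
    have h2 := hfar (i + 1) (by omega)
    have h3 := rel_origin_contour h η hrec (K := K) hsymm htrans hadj (c := pos i)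
      (hfar i (by omega)) (by rw [← h1]; exact h2) (hsucc i (by omega))
    rw [← h1] at h3
    exact h3
  have hright : ∀ k : ℕ, rel (P (N + 1)) (P (N + 1 + k)) := by
    intro k
    induction k with
    | zero =>
      rw [Nat.cast_zero, add_zero]
      exact ⟨hfar _ (by omega), hfar _ (by omega), SimpleGraph.Reachable.refl _⟩
    | succ k ih =>
      have := htrans _ _ _ ih (hstep _ (by omega))
      rwa [add_assoc] at this
  have hleft : ∀ k : ℕ, rel (P (-M - 1 - k)) (P (-M - 1)) := by
    intro k
    induction k with
    | zero =>
      rw [Nat.cast_zero, sub_zero]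
      exact ⟨hfar _ (by omega), hfar _ (by omega), SimpleGraph.Reachable.refl _⟩
    | succ k ih =>
      have := hstep (-M - 1 - (k + 1 : ℕ)) (by omega)
      rw [show -(M : ℤ) - 1 - (k + 1 : ℕ) + 1 = -M - 1 - k by push_cast; ring] at this
      exact htrans _ _ _ this ih
  -- A far vertex of the spine appears in both tails and joins them.
  obtain ⟨c, c', hcc, -, ⟨N₁, hN₁, hc⟩, N₂, hN₂, hc'⟩ := hS.exists_far h (M + 1) 0
  have hlink : P N₁ = P (-N₂) := by
    have := origin_eq_of_vert_eq h η hrec hcc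
    rw [← hc, ← hc', back_eq, ← zpow_natCast, ← zpow_natCast, ← zpow_neg] at this
    exact this
  have hall : ∀ i : ℤ, ((N : ℤ) < i ∨ i < -(M : ℤ)) → rel (P (N + 1)) (P i) := by
    intro i hi
    rcases hi with hi | hi
    · have := hright (i - N - 1).toNat
      rwa [Int.toNat_of_nonneg (by omega), show (N : ℤ) + 1 + (i - N - 1) = i by ring] at this
    · have h1 := hright (N₁ - N - 1 : ℤ).toNat
      rw [Int.toNat_of_nonneg (by omega), show (N : ℤ) + 1 + (N₁ - N - 1) = N₁ by ring,
        hlink] at h1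
      have h2 := hleft (N₂ - M - 1 : ℤ).toNat
      rw [Int.toNat_of_nonneg (by omega), show -(M : ℤ) - 1 - (N₂ - M - 1) = -N₂ by ring] at h2
      have h3 := hleft (-i - M - 1).toNat
      rw [Int.toNat_of_nonneg (by omega), show -(M : ℤ) - 1 - (-i - M - 1) = i by ring] at h3
      exact htrans _ _ _ h1 (htrans _ _ _ h2 (hsymm _ _ h3))
  have : Infinite m.Vertex := hS.infinite_vertex h η
  have : Infinite K := hA.infinite_compl.to_subtype
  refine SimpleGraph.existsUnique_infinite_component (G := m.graph.induce K)
    ⟨P (N + 1), hfar _ (by omega)⟩ ?_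
  refine Set.Finite.of_finite_image (f := Subtype.val) ?_ Subtype.val_injective.injOn
  refine ((Set.finite_Icc (-(M : ℤ)) N).image P).subset ?_
  rintro _ ⟨⟨v, hv⟩, hvr, rfl⟩
  obtain ⟨i, rfl⟩ := hsurj v
  refine ⟨i, ?_, rfl⟩
  by_contra hi
  rw [Set.mem_Icc] at hi
  obtain ⟨h1, h2, hr⟩ := hall i (by omega)
  exact hvr hr

end IsGoodSpine

end LabeledTree

namespace LabeledTree

variable {θ θ' θ'' : LabeledTree}

/-! ### Trees with the same balls -/

theorem SameBall.refl (H : ℕ) (θ : LabeledTree) : SameBall H θ θ :=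
  fun _ _ => ⟨Iff.rfl, fun _ _ => rfl⟩

theorem SameBall.mono {H K : ℕ} (hHK : H ≤ K) (h : SameBall K θ θ') : SameBall H θ θ' :=
  fun u hu => h u (hu.trans hHK)

theorem SameBall.trans {H : ℕ} (h : SameBall H θ θ') (h' : SameBall H θ' θ'') :
    SameBall H θ θ'' := fun u hu =>
  ⟨(h u hu).1.trans (h' u hu).1, fun h1 h2 =>
    ((h u hu).2 h1 ((h u hu).1.1 h1)).trans ((h' u hu).2 _ h2)⟩

theorem SameBall.numChildren_eq {H : ℕ} (h : SameBall H θ θ') {u : List ℕ} (hu : u.length < H) :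
    θ'.numChildren u = θ.numChildren u := by
  refine eq_of_forall_lt_iff fun j => ?_
  rw [← θ.child_mem_iff, ← θ'.child_mem_iff]
  exact (h (j :: u) (by simpa using hu)).1.symm

theorem SameBall.isCorner_iff {H : ℕ} (h : SameBall H θ θ') {c : List ℕ × ℕ}
    (hc : c.1.length < H) : θ'.IsCorner c ↔ θ.IsCorner c := by
  have h0 : ([] : List ℕ).length < H := (Nat.zero_le _).trans_lt hc
  rw [IsCorner, IsCorner, h.numChildren_eq hc, h.numChildren_eq h0, (h c.1 hc.le).1]

theorem SameBall.nextFun_eq {H : ℕ} (h : SameBall H θ θ') {c : List ℕ × ℕ}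
    (hc : c.1.length < H) : θ'.nextFun c = θ.nextFun c := by
  have h0 : ([] : List ℕ).length < H := (Nat.zero_le _).trans_lt hc
  obtain ⟨u, i⟩ := c
  have hu := h.numChildren_eq hc
  dsimp only at hu
  simp only [nextFun, hu, h.numChildren_eq h0]

/-- The filter of the properties that hold for all trees that are close to `θ`. -/
def near (θ : LabeledTree) : Filter LabeledTree where
  sets := {s | ∃ H, ∀ θ', SameBall H θ θ' → θ' ∈ s}
  univ_sets := ⟨0, fun _ _ => trivial⟩
  sets_of_superset := fun ⟨H, hH⟩ hst => ⟨H, fun θ' h => hst (hH θ' h)⟩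
  inter_sets := fun ⟨H, hH⟩ ⟨K, hK⟩ => ⟨max H K, fun θ' h =>
    ⟨hH θ' (h.mono (le_max_left _ _)), hK θ' (h.mono (le_max_right _ _))⟩⟩

theorem eventually_near_iff {p : LabeledTree → Prop} :
    (∀ᶠ θ' in near θ, p θ') ↔ ∃ H, ∀ θ', SameBall H θ θ' → p θ' := Iff.rfl

open Classical in
/-- The corner of another tree that is denoted by the same word and the same number, if there is
one. -/
def transfer (c₀ : θ'.Corner) (c : θ.Corner) : θ'.Corner :=
  if h : θ'.IsCorner c.1 then ⟨c.1, h⟩ else c₀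

theorem eventually_coe_transfer (c : θ.Corner) :
    ∀ᶠ θ' in near θ, ∀ c₀ : θ'.Corner, (transfer c₀ c).1 = c.1 := by
  refine eventually_near_iff.2 ⟨c.1.1.length + 1, fun θ' h c₀ => ?_⟩
  have hc : θ'.IsCorner c.1 := (h.isCorner_iff (Nat.lt_succ_self _)).2 c.2
  have : transfer c₀ c = θ'.corner c.1.1 c.1.2 hc := dif_pos hc
  rw [this]
  rfl

theorem eventually_cornerLabel_transfer (c : θ.Corner) :
    ∀ᶠ θ' in near θ, ∀ c₀ : θ'.Corner,
      θ'.cornerLabel (transfer c₀ c) = θ.cornerLabel c := by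
  have h1 : ∀ᶠ θ' in near θ, SameBall (c.1.1.length) θ θ' :=
    eventually_near_iff.2 ⟨_, fun θ' h => h⟩
  filter_upwards [eventually_coe_transfer c, h1] with θ' h h1 c₀
  have h := h c₀
  obtain ⟨u, i, hc, h'⟩ := exists_eq_corner (transfer c₀ c)
  rw [h'] at h ⊢
  obtain ⟨v, j, hd, rfl⟩ := exists_eq_corner c
  rw [coe_corner, coe_corner] at h
  obtain rfl : u = v := congrArg Prod.fst h
  exact ((h1 u le_rfl).2 hd.1 hc.1).symm

theorem eventually_transfer_contour (c : θ.Corner) :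
    ∀ᶠ θ' in near θ, ∀ c₀ : θ'.Corner,
      transfer c₀ (θ.contour c) = θ'.contour (transfer c₀ c) := by
  have h1 : ∀ᶠ θ' in near θ, SameBall (c.1.1.length + 1) θ θ' :=
    eventually_near_iff.2 ⟨_, fun θ' h => h⟩
  filter_upwards [eventually_coe_transfer c, eventually_coe_transfer (θ.contour c), h1]
    with θ' h h' h1 c₀
  apply Corner.ext
  rw [h']
  change θ.nextFun c.1 = θ'.nextFun (transfer c₀ c).1
  rw [h, h1.nextFun_eq (Nat.lt_succ_self _)]

theorem eventually_transfer_contour_pow (c : θ.Corner) (n : ℕ) :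
    ∀ᶠ θ' in near θ, ∀ c₀ : θ'.Corner,
      transfer c₀ ((θ.contour ^ n) c) = (θ'.contour ^ n) (transfer c₀ c) := by
  induction n with
  | zero => exact Filter.Eventually.of_forall fun θ' c₀ => rfl
  | succ n ih =>
    filter_upwards [ih, eventually_transfer_contour ((θ.contour ^ n) c)] with θ' h h' c₀
    rw [contour_pow_succ, contour_pow_succ, h', h]

/-- Backward steps from `c` are forward steps from the corner `back n c`, which is fixed. -/
theorem eventually_transfer_back (c : θ.Corner) (n : ℕ) :
    ∀ᶠ θ' in near θ, ∀ c₀ : θ'.Corner,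
      transfer c₀ (θ.back n c) = θ'.back n (transfer c₀ c) := by
  filter_upwards [eventually_transfer_contour_pow (θ.back n c) n] with θ' h c₀
  have h := h c₀
  rw [contour_pow_back] at h
  rw [h, back_contour_pow]

theorem eventually_transfer_nextAround (c : θ.Corner) :
    ∀ᶠ θ' in near θ, ∀ c₀ : θ'.Corner,
      transfer c₀ (θ.nextAround c) = θ'.nextAround (transfer c₀ c) := by
  have h1 : ∀ᶠ θ' in near θ, SameBall (c.1.1.length + 1) θ θ' :=
    eventually_near_iff.2 ⟨_, fun θ' h => h⟩
  filter_upwards [eventually_coe_transfer c, eventually_coe_transfer (θ.nextAround c), h1]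
    with θ' h h' h1 c₀
  apply Corner.ext
  have hiff := h1.isCorner_iff (c := (c.1.1, c.1.2 + 1)) (Nat.lt_succ_self _)
  rw [h']
  by_cases hc : θ.IsCorner (c.1.1, c.1.2 + 1)
  · rw [coe_nextAround_of_isCorner hc, coe_nextAround_of_isCorner, h]
    rwa [h, hiff]
  · rw [coe_nextAround_of_not_isCorner hc, coe_nextAround_of_not_isCorner, h]
    rwa [h, hiff]

theorem eventually_transfer_opp (c : θ.Corner) :
    ∀ᶠ θ' in near θ, ∀ c₀ : θ'.Corner,
      transfer c₀ (θ.opp c) = θ'.opp (transfer c₀ c) := by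
  filter_upwards [eventually_transfer_contour (θ.opp c), eventually_transfer_nextAround c]
    with θ' h h' c₀
  have h := h c₀
  rw [contour_opp, h', ← contour_opp] at h
  exact (θ'.contour.injective h).symm

/-! ### Locality of the rotation and continuity at trees with a spine -/

/-- The dart of another tree with the same corner and the same direction. -/
def transferDart (c₀ : θ'.Corner) (d : θ.ArcDart) : θ'.ArcDart := (transfer c₀ d.1, d.2)

theorem eventually_transferDart_arcRot_true (c : θ.Corner) :
    ∀ᶠ θ' in near θ, ∀ c₀ : θ'.Corner,
      transferDart c₀ (θ.arcRot (c, true)) = θ'.arcRot (transferDart c₀ (c, true)) := by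
  filter_upwards [eventually_cornerLabel_transfer c, eventually_cornerLabel_transfer (θ.opp c),
    eventually_transfer_nextAround c, eventually_transfer_opp c] with θ' h1 h2 h3 h4 c₀
  have h1 := h1 c₀
  have h2 := h2 c₀
  have h3 := h3 c₀
  have h4 := h4 c₀
  rw [h4] at h2
  have habs := abs_le.1 (abs_cornerLabel_opp_sub_le c)
  change _ = θ'.arcRot (transfer c₀ c, true)
  rcases lt_or_ge (θ.cornerLabel c) (θ.cornerLabel (θ.opp c)) with h | h
  · rw [arcRot_true_of_eq_add_one (by omega), arcRot_true_of_eq_add_one (by omega), ← h4]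
    rfl
  · rw [arcRot_true_of_le h, arcRot_true_of_le (by omega), ← h3]
    rfl

theorem eventually_hits {c s : θ.Corner} {n : ℕ} (hc : θ.Hits c s n) :
    ∀ᶠ θ' in near θ, ∀ c₀ : θ'.Corner, θ'.Hits (transfer c₀ c) (transfer c₀ s) n := by
  obtain ⟨hn, rfl, hl, hi⟩ := hc
  have h1 : ∀ᶠ θ' in near θ, ∀ i ∈ Set.Iic n, ∀ c₀ : θ'.Corner,
      θ'.cornerLabel ((θ'.contour ^ i) (transfer c₀ c)) =
        θ.cornerLabel ((θ.contour ^ i) c) := by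
    refine (Filter.eventually_all_finite (Set.finite_Iic n)).2 fun i _ => ?_
    filter_upwards [eventually_transfer_contour_pow c i,
      eventually_cornerLabel_transfer ((θ.contour ^ i) c)] with θ' h h' c₀
    rw [← h, h']
  filter_upwards [h1, eventually_transfer_contour_pow c n] with θ' h1 h2 c₀
  have h0 : θ'.cornerLabel (transfer c₀ c) = θ.cornerLabel c := h1 0 (Nat.zero_le n) c₀
  refine ⟨hn, (h2 c₀).symm, ?_, fun i hin => ?_⟩
  · rw [h2, h1 n (Set.mem_Iic.2 le_rfl), h0, hl]
  · rw [h0, h1 i hin.le]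
    exact hi i hin

/-- If the preceding label is smaller, the rotation leads to the successor, which is read off
finitely many steps ahead. Otherwise it leads to the last earlier corner with label `ℓ(c)`, which
recurrence places finitely many steps back. -/
theorem eventually_transferDart_arcRot_false (hθ : θ.Recurrent) (c : θ.Corner)
    (hc : θ.succ c ≠ none) :
    ∀ᶠ θ' in near θ, ∀ c₀ : θ'.Corner,
      transferDart c₀ (θ.arcRot (c, false)) = θ'.arcRot (transferDart c₀ (c, false)) := by
  have hback : ∀ i, ∀ᶠ θ' in near θ, ∀ c₀ : θ'.Corner,
      θ'.cornerLabel (θ'.back i (transfer c₀ c)) = θ.cornerLabel (θ.back i c) := fun i => by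
    filter_upwards [eventually_transfer_back c i,
      eventually_cornerLabel_transfer (θ.back i c)] with θ' h h' c₀
    rw [← h, h']
  have habs := cornerLabel_back_ge c 0
  rw [back_zero, zero_add] at habs
  rcases lt_or_ge (θ.cornerLabel (θ.back 1 c)) (θ.cornerLabel c) with hlt | hge
  · obtain ⟨s, hs⟩ := Option.ne_none_iff_exists'.1 hc
    obtain ⟨n, hn⟩ := succ_eq_some_iff.1 hs
    filter_upwards [hback 0, hback 1, eventually_hits hn] with θ' h0 h1 hn' c₀
    have h0 := h0 c₀
    have h1 := h1 c₀
    rw [back_zero, back_zero] at h0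
    change _ = θ'.arcRot (transfer c₀ c, false)
    rw [arcRot_false_of_eq_sub_one (by rw [← back_one]; omega) hs,
      arcRot_false_of_eq_sub_one (by rw [← back_one]; omega)
        (succ_eq_some_iff.2 ⟨n, hn' c₀⟩)]
    rfl
  · obtain ⟨n, hn, hle⟩ := (hθ c).2
    obtain ⟨k, -, hl, hi⟩ := exists_first_eq (f := fun i => θ.cornerLabel (θ.back (i + 1) c))
      (fun i => cornerLabel_back_ge c (i + 1)) (a := θ.cornerLabel c) (n := n - 1) hge
      (by rwa [Nat.sub_add_cancel hn])
    have hi' : ∀ i, 0 < i → i < k + 1 → θ.cornerLabel c < θ.cornerLabel (θ.back i c) := by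
      intro i h0 hik
      have := hi (i - 1) (by omega)
      rwa [Nat.sub_add_cancel h0] at this
    have hall : ∀ᶠ θ' in near θ, ∀ i ∈ Set.Iic (k + 1), ∀ c₀ : θ'.Corner,
        θ'.cornerLabel (θ'.back i (transfer c₀ c)) = θ.cornerLabel (θ.back i c) :=
      (Filter.eventually_all_finite (Set.finite_Iic _)).2 fun i _ => hback i
    filter_upwards [hall, eventually_transfer_back c (k + 1)] with θ' h1 h2 c₀
    have h0 : θ'.cornerLabel (transfer c₀ c) = θ.cornerLabel c := h1 0 (Nat.zero_le _) c₀
    change _ = θ'.arcRot (transfer c₀ c, false)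
    rw [arcRot_false_of_eq (Nat.succ_pos k) hl hi',
      arcRot_false_of_eq (c := transfer c₀ c) (Nat.succ_pos k) ?_ fun i hi0 hik => ?_, ← h2]
    · rfl
    · rw [h1 (k + 1) (Set.mem_Iic.2 le_rfl), h0, hl]
    · rw [h1 i hik.le, h0]
      exact hi' i hi0 hik

/-- By local finiteness only finitely many darts have to be checked, so the neighbourhoods of `θ`
that they require can be intersected. -/
theorem IsGoodSpine.eventually_isLocalIso {S : ℕ → θ.verts} (hS : θ.IsGoodSpine S)
    (h : 0 < θ.numChildren []) (η : Bool) (R : ℕ) :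
    ∀ᶠ θ' in near θ, ∀ h' : 0 < θ'.numChildren [],
      RootedMap.IsLocalIso (m := θ.schaefferMap h η) (m' := θ'.schaefferMap h' η)
        (transferDart (θ'.rootCorner h')) R := by
  have hfin := RootedMap.finite_rootDist_le (hS.isQuadrangulation h η).locallyFinite R
  have hrot : ∀ᶠ θ' in near θ, ∀ d ∈ {d | (θ.schaefferMap h η).rootDist d ≤ R},
      ∀ c₀ : θ'.Corner, transferDart c₀ (θ.arcRot d) = θ'.arcRot (transferDart c₀ d) := by
    refine (Filter.eventually_all_finite hfin).2 fun d _ => ?_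
    obtain ⟨c, b⟩ := d
    cases b
    · exact eventually_transferDart_arcRot_false (hS.recurrent h) c (hS.succ_ne_none h c)
    · exact eventually_transferDart_arcRot_true c
  have hcoe : ∀ᶠ θ' in near θ, ∀ d ∈ {d | (θ.schaefferMap h η).rootDist d ≤ R},
      ∀ c₀ : θ'.Corner, (transfer c₀ (Prod.fst (α := θ.Corner) d)).1 =
        (Prod.fst (α := θ.Corner) d).1 :=
    (Filter.eventually_all_finite hfin).2 fun d _ => eventually_coe_transfer _
  filter_upwards [hrot, hcoe, eventually_coe_transfer (θ.rootCorner h)] with θ' h1 h2 h3 h'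
  refine ⟨?_, fun d hd => h1 d hd _, fun d _ => rfl, fun d d' hd hd' heq => ?_⟩
  · exact Prod.ext (Corner.ext (h3 _)) rfl
  · have e1 : transfer (θ'.rootCorner h') (Prod.fst (α := θ.Corner) d) =
        transfer (θ'.rootCorner h') (Prod.fst (α := θ.Corner) d') :=
      congrArg (Prod.fst (α := θ'.Corner)) heq
    have e2 := congrArg Subtype.val e1
    exact Prod.ext (Corner.ext ((h2 d hd _).symm.trans (e2.trans (h2 d' hd' _))))
      (congrArg (Prod.snd (α := θ'.Corner)) heq)

theorem IsGoodSpine.eventually_ball_eq {S : ℕ → θ.verts} (hS : θ.IsGoodSpine S)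
    (h : 0 < θ.numChildren []) (η : Bool) {r : ℕ} (hr : 0 < r) :
    ∀ᶠ θ' in near θ, ∀ h' : 0 < θ'.numChildren [], θ' ∈ oneSpineTrees ∪ finiteTrees →
      (θ.schaefferMap h η).toClass.ball r hr = (θ'.schaefferMap h' η).toClass.ball r hr := by
  filter_upwards [hS.eventually_isLocalIso h η (r + 20)] with θ' hiso h' hθ'
  exact Quotient.sound ((hiso h').nonempty_ball_iso (hS.isQuadrangulation h η)
    (isQuadrangulation_of_mem hθ' h' η) hr)

/-! ### Finite trees close to a given tree -/

theorem eq_of_sameBall_of_finite (hfin : θ.verts.Finite) :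
    ∃ H, ∀ θ', SameBall H θ θ' → θ' = θ := by
  obtain ⟨H, hH⟩ := (hfin.image List.length).bddAbove
  -- One more than the height of `θ`: the ball then shows that there is no vertex at height `H + 1`,
  -- hence none beyond.
  refine ⟨H + 1, fun θ' h => ?_⟩
  have hlen : ∀ u ∈ θ.verts, u.length ≤ H := fun u hu => hH ⟨u, hu, rfl⟩
  have hlen' : ∀ u ∈ θ'.verts, u.length ≤ H := by
    intro u hu
    induction u with
    | nil => exact Nat.zero_le _
    | cons j v ih =>
      have hv := ih (θ'.parent_mem v j hu)
      exact hlen _ ((h (j :: v) (by simpa using hv)).1.2 hu)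
  have hverts : θ'.verts = θ.verts := Set.ext fun u =>
    ⟨fun hu => (h u ((hlen' u hu).trans (Nat.le_succ _))).1.2 hu,
      fun hu => (h u ((hlen u hu).trans (Nat.le_succ _))).1.1 hu⟩
  have hnum : θ'.numChildren = θ.numChildren := funext fun u => by
    refine eq_of_forall_lt_iff fun j => ?_
    rw [← θ.child_mem_iff, ← θ'.child_mem_iff, hverts]
  have hlabel : ∀ u (hu : u ∈ θ.verts) (hu' : u ∈ θ'.verts),
      θ'.label ⟨u, hu'⟩ = θ.label ⟨u, hu⟩ := fun u hu hu' =>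
    ((h u ((hlen u hu).trans (Nat.le_succ _))).2 hu hu').symm
  clear h hlen hlen' hH
  obtain ⟨⟨V, h1, h2, k, h3⟩, l, h4⟩ := θ
  obtain ⟨⟨V', h1', h2', k', h3'⟩, l', h4'⟩ := θ'
  dsimp only at hverts hnum hlabel
  subst hverts hnum
  obtain rfl : l' = l := funext fun u => hlabel u.1 u.2 u.2
  rfl

/-- The vertices up to height `H` of a labeled tree. -/
def truncate (θ : LabeledTree) (H : ℕ) : LabeledTree where
  verts := {u | u ∈ θ.verts ∧ u.length ≤ H}
  root_mem := ⟨θ.root_mem, Nat.zero_le _⟩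
  parent_mem u j h := ⟨θ.parent_mem u j h.1, (Nat.le_succ _).trans h.2⟩
  numChildren u := if u.length < H then θ.numChildren u else 0
  child_mem_iff u j := by
    split_ifs with h
    · rw [← θ.child_mem_iff]
      exact and_iff_left (by simpa using h)
    · simp only [not_lt_zero, iff_false]
      exact fun h' => h (by simpa using h'.2)
  label u := θ.label ⟨u.1, u.2.1⟩
  abs_label_sub_le u j h := θ.abs_label_sub_le u j h.1

theorem sameBall_truncate (θ : LabeledTree) (H : ℕ) : SameBall H θ (θ.truncate H) :=
  fun _ hu => ⟨⟨fun h => ⟨h, hu⟩, fun h => h.1⟩, fun _ _ => rfl⟩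

theorem finite_setOf_length_le (θ : LabeledTree) (H : ℕ) :
    {u | u ∈ θ.verts ∧ u.length ≤ H}.Finite := by
  induction H with
  | zero =>
    refine (Set.finite_singleton []).subset fun u hu => ?_
    exact List.length_eq_zero_iff.1 (Nat.le_zero.1 hu.2)
  | succ H ih =>
    refine ((Set.finite_singleton []).union (ih.biUnion fun u _ =>
      (Set.finite_Iio (θ.numChildren u)).image fun j => j :: u)).subset ?_
    rintro (_ | ⟨j, u⟩) hu
    · exact Or.inl rfl
    · exact Or.inr (Set.mem_biUnion (x := u)
        ⟨θ.parent_mem u j hu.1, by simpa using hu.2⟩ ⟨j, (θ.child_mem_iff u j).1 hu.1, rfl⟩)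

theorem truncate_mem_finiteTrees (h0 : θ.label θ.rootVert = 0) (h : 0 < θ.numChildren []) {H : ℕ}
    (hH : 0 < H) : θ.truncate H ∈ finiteTrees := by
  refine ⟨θ.finite_setOf_length_le H, h0, ?_⟩
  change 0 < if _ then _ else _
  rwa [if_pos (by exact hH)]

end LabeledTree

/-! ### Local distances -/

theorem localDist_le {P : ℕ → Prop} {r : ℕ} (h : P r) : localDist P ≤ (1 + (r : ℝ≥0∞))⁻¹ :=
  ENNReal.inv_le_inv.2 (add_le_add le_rfl (le_iSup₂_of_le r h le_rfl))

theorem exists_lt_of_localDist_lt {P : ℕ → Prop} {r : ℕ}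
    (h : localDist P < (1 + (r : ℝ≥0∞))⁻¹) : ∃ k > r, P k := by
  have h1 := lt_of_add_lt_add_left (ENNReal.inv_lt_inv.1 h)
  simp only [lt_iSup_iff] at h1
  obtain ⟨k, hk, hlt⟩ := h1
  exact ⟨k, by exact_mod_cast hlt, hk⟩

theorem exists_one_add_inv_lt {ε : ℝ≥0∞} (hε : 0 < ε) :
    ∃ r : ℕ, 0 < r ∧ (1 + (r : ℝ≥0∞))⁻¹ < ε := by
  obtain ⟨n, hn⟩ := ENNReal.exists_inv_nat_lt hε.ne'
  refine ⟨n + 1, Nat.succ_pos n, lt_of_le_of_lt (ENNReal.inv_le_inv.2 ?_) hn⟩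
  push_cast
  exact le_self_add.trans le_add_self

theorem QuadSpace.exists_of_isOpen {U : Set QuadSpace} (hU : IsOpen U) {x : QuadSpace}
    (hx : x ∈ U) :
    ∃ (r : ℕ) (hr : 0 < r), ∀ y : QuadSpace, x.1.ball r hr = y.1.ball r hr → y ∈ U := by
  obtain ⟨ε, hε, h⟩ := hU x hx
  obtain ⟨r, hr, hlt⟩ := exists_one_add_inv_lt hε
  exact ⟨r, hr, fun y hy => h y ((localDist_le ⟨hr, hy⟩).trans_lt hlt)⟩

namespace LabeledTree

theorem isOpen_of_sameBall {U : Set LabeledTree}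
    (h : ∀ θ ∈ U, ∃ H, ∀ θ', SameBall H θ θ' → θ' ∈ U) : IsOpen U := by
  intro θ hθ
  obtain ⟨H, hH⟩ := h θ hθ
  refine ⟨(1 + (H : ℝ≥0∞))⁻¹, ENNReal.inv_pos.2 (ENNReal.add_ne_top.2
    ⟨ENNReal.one_ne_top, ENNReal.natCast_ne_top H⟩), fun θ' hlt => ?_⟩
  obtain ⟨k, hk, hs⟩ := exists_lt_of_localDist_lt hlt
  exact hH θ' (hs.mono hk.le)

/-- A function on a set of labeled trees is continuous if its values stay in a given open set as
long as a large enough ball of the tree is fixed. -/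
theorem continuous_of_eventually_near {X : Type*} [TopologicalSpace X] {T : Set LabeledTree}
    {g : T → X} (hg : ∀ U, IsOpen U → ∀ θ : T, g θ ∈ U →
      ∀ᶠ θ' in near θ.1, ∀ h : θ' ∈ T, g ⟨θ', h⟩ ∈ U) : Continuous g := by
  -- The open set of all labeled trees is made of those near which `g` takes its values in `U`; it
  -- is open because having the same ball is transitive.
  refine continuous_def.2 fun U hU => isOpen_induced_iff.2
    ⟨{θ' | ∀ᶠ θ'' in near θ', ∀ h : θ'' ∈ T, g ⟨θ'', h⟩ ∈ U}, ?_, ?_⟩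
  · refine isOpen_of_sameBall fun θ ⟨H, hH⟩ => ⟨H, fun θ' h' => ⟨H, fun θ'' h'' => ?_⟩⟩
    exact hH θ'' (h'.trans h'')
  · ext θ
    refine ⟨fun h => ?_, hg U hU θ⟩
    obtain ⟨H, hH⟩ := eventually_near_iff.1 h
    exact hH θ.1 (SameBall.refl H _) θ.2

/-! ### The mapping into the space of quadrangulations -/

/-- The Schaeffer map, as a point of the space of quadrangulations. -/
def schaefferQuad (η : Bool) (θ : ↥(oneSpineTrees ∪ finiteTrees)) : QuadSpace :=
  ⟨(θ.1.schaefferMap (numChildren_root_pos θ.2) η).toClass, _, rfl,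
    isQuadrangulation_of_mem θ.2 _ η⟩

theorem schaefferQuad_mem_finiteQuad (η : Bool) {θ : ↥(oneSpineTrees ∪ finiteTrees)}
    (hθ : θ.1 ∈ finiteTrees) : schaefferQuad η θ ∈ finiteQuad :=
  ⟨_, rfl, isFinitePlanarQuadrangulation_schaefferMap _ η hθ⟩

theorem eventually_schaefferQuad_mem (η : Bool) {U : Set QuadSpace} (hU : IsOpen U)
    (θ : ↥(oneSpineTrees ∪ finiteTrees)) (hθU : schaefferQuad η θ ∈ U) :
    ∀ᶠ θ' in near θ.1, ∀ h : θ' ∈ oneSpineTrees ∪ finiteTrees,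
      schaefferQuad η ⟨θ', h⟩ ∈ U := by
  obtain ⟨θ, hθ⟩ := θ
  rcases id hθ with hθ' | hθ'
  · obtain ⟨r, hr, h⟩ := QuadSpace.exists_of_isOpen hU hθU
    obtain ⟨S, hS⟩ := exists_isGoodSpine hθ'
    filter_upwards [hS.eventually_ball_eq (numChildren_root_pos hθ) η hr] with θ' hb hT
    exact h _ (hb _ hT)
  · obtain ⟨H, hH⟩ := eq_of_sameBall_of_finite hθ'.1
    refine eventually_near_iff.2 ⟨H, fun θ' h hT => ?_⟩
    obtain rfl := hH θ' h
    exact hθU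

theorem schaefferQuad_mem_quad (η : Bool) (θ : ↥(oneSpineTrees ∪ finiteTrees)) :
    schaefferQuad η θ ∈ Quad := by
  rcases θ.2 with hθ | hθ
  · refine mem_closure_iff.2 fun U hU hθU => ?_
    obtain ⟨H, hH⟩ := eventually_near_iff.1 (eventually_schaefferQuad_mem η hU θ hθU)
    have hfin := truncate_mem_finiteTrees hθ.2.1 (numChildren_root_pos θ.2) (Nat.succ_pos H)
    -- Truncation at height `H + 1`, not `H`, guarantees at least one edge.
    exact ⟨_, hH _ ((sameBall_truncate θ.1 (H + 1)).mono (Nat.le_succ H)) (Or.inr hfin),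
      schaefferQuad_mem_finiteQuad η hfin⟩
  · exact subset_closure (schaefferQuad_mem_finiteQuad η hθ)

theorem schaefferQuad_mem_planeQuad (η : Bool) (θ : ↥(oneSpineTrees ∪ finiteTrees))
    (hθ : θ.1 ∈ oneSpineTrees) : schaefferQuad η θ ∈ planeQuad := by
  obtain ⟨S, hS⟩ := exists_isGoodSpine hθ
  have h := numChildren_root_pos θ.2
  refine ⟨⟨schaefferQuad_mem_quad η θ, ?_⟩, _, rfl, hS.oneEnded h η⟩
  rintro ⟨m, hm, hfin⟩
  obtain ⟨e⟩ : Nonempty (RootedMap.Iso m (θ.1.schaefferMap h η)) := Quotient.exact hm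
  have := hfin.finite
  have hd : Finite (θ.1.Corner × Bool) := Finite.of_equiv _ e.toEquiv
  have := hS.infinite_corner h
  exact not_finite (θ.1.Corner × Bool)

end LabeledTree

end

theorem proposition1 :
    ∃ Φ : Bool → ↥(LabeledTree.oneSpineTrees ∪ LabeledTree.finiteTrees) → ↥Quad,
      (∀ η θ, (Φ η θ).1.1 =
        (θ.1.schaefferMap (LabeledTree.numChildren_root_pos θ.2) η).toClass) ∧
      (∀ η θ, θ.1 ∈ LabeledTree.oneSpineTrees → (Φ η θ).1 ∈ planeQuad) ∧
      ∀ η, Continuous (Φ η) :=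
  ⟨fun η θ => ⟨LabeledTree.schaefferQuad η θ, LabeledTree.schaefferQuad_mem_quad η θ⟩,
    fun _ _ => rfl, LabeledTree.schaefferQuad_mem_planeQuad, fun η =>
    (LabeledTree.continuous_of_eventually_near fun _ hU =>
      LabeledTree.eventually_schaefferQuad_mem η hU).subtype_mk _⟩
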